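/- Let $X$ be a proper ${\rm CAT}(0)$-space with visual boundary $\partial X$. A geodesic $\gamma:\mathbb R\to X$ is called $B$-contracting $(B>0)$ if for every closed metric ball $K\subset X$ disjoint from $\gamma(\mathbb R)$ the shortest distance projection $\pi_{\gamma(\mathbb R)}(K)$ has diameter at most $B$. Let ${\cal A}(B)\subset\partial X\times\partial X-\Delta$ be the set of all pairs $(\gamma(-\infty),\gamma(\infty))$ where $\gamma:\mathbb R\to X$ is a $B$-contracting geodesic. For $x\in X$ and geodesics $\zeta_1,\zeta_2:\mathbb R\to X$ let $[a_i,b_i]=\{t\mid d(\zeta_i(t),\zeta_{i+1}(\mathbb R))\le 6B+2\}$ (indices modulo two; the ends may be infinite), let $\zeta_i(s_i)$, $\zeta_i(t_i)$ be the projections to $\zeta_i$ of $\zeta_{i+1}(a_{i+1})$, $\zeta_{i+1}(b_{i+1})$, and let $x_i=\pi_{\zeta_i(\mathbb R)}(x)$. (The projection to a geodesic of a point of $\partial X$ is defined through the minimum of its Busemann function; it is an end of the geodesic if the Busemann function has no minimum there and approaches its infimum at that end.) If these intervals are not empty and if $s_i<t_i$ and $x_i\in\zeta_i[a_i,b_i]$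 for $i=1,2$, put $\tau_B(x,\zeta_1,\zeta_2)=\min\{d(x_i,\zeta_i(a_i)),d(x_i,\zeta_i(b_i))\mid i=1,2\}$, where the distance to a point at infinity is $\infty$; otherwise put $\tau_B(x,\zeta_1,\zeta_2)=0$. For $\alpha_1\neq\alpha_2$ in ${\cal A}(B)$ let $\tau_B(x,\alpha_1,\alpha_2)$, which is finite, be the infimum of $\tau_B(x,\zeta_1,\zeta_2)$ over all $B$-contracting geodesics $\zeta_i$ connecting the two components of $\alpha_i$. For $\chi>0$ put $\tilde\delta_x(\alpha_1,\alpha_2)=e^{-\chi\tau_B(x,\alpha_1,\alpha_2)}$ if $\alpha_1\ne\alpha_2$ and $\tilde\delta_x(\alpha,\alpha)=0$. There is a universal constant $L>0$ such that the following holds for every $B>0$, every $\chi>0$ with $\chi'=e^{\chi L(B+1)}-1<\sqrt2-1$, and every proper ${\rm CAT}(0)$-space $X$. There is a family $\{\delta_x\}_{x\in X}$ of metrics on ${\cal A}(B)$ such that: 1. for every $x$ the topology on ${\cal A}(B)$ defined by $\delta_x$ is the restriction of the product topology on $\partial X\times\partial X-\Delta$; in particular, $({\cal A}(B),\delta_x)$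 is locally compact; 2. $\delta_x(\iota\alpha,\iota\beta)=\delta_x(\alpha,\beta)$ for the involution $\iota:(\xi,\eta)\to(\eta,\xi)$ of ${\cal A}(B)$; 3. $(1-2\chi')\tilde\delta_x\le\delta_x\le\tilde\delta_x$ for all $x\in X$; 4. $e^{-\chi d(x,y)}\delta_x\le\delta_y\le e^{\chi d(x,y)}\delta_x$ for all $x,y\in X$; 5. $\delta_{gx}(g\alpha,g\beta)=\delta_x(\alpha,\beta)$ for all $g\in{\rm Iso}(X)$, $x\in X$, $\alpha,\beta\in{\cal A}(B)$. -/

import Mathlib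

open Set Filter Topology
open scoped NNReal ENNReal

universe u

/-- A CAT(0) space: a geodesic metric space in which every geodesic triangle is at least as thin as
its Euclidean comparison triangle. The second field compares the distance from a vertex `p` to the
point `m` of a geodesic side `[y, z]` that divides it in the ratio `t : 1 - t`; its right-hand side
is the squared distance of the corresponding points of the comparison triangle. -/
class IsCAT0 (X : Type u) [MetricSpace X] : Prop where
  exists_geodesic : ∀ x y : X, ∃ c : ℝ → X, c 0 = x ∧ c (dist x y) = y ∧
    ∀ s ∈ Icc 0 (dist x y), ∀ t ∈ Icc 0 (dist x y), dist (c s) (c t) = |s - t|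
  comparison : ∀ (p y z m : X) (t : ℝ), t ∈ Icc (0 : ℝ) 1 →
    dist y m = t * dist y z → dist m z = (1 - t) * dist y z →
    dist p m ^ 2 ≤ (1 - t) * dist p y ^ 2 + t * dist p z ^ 2 - t * (1 - t) * dist y z ^ 2

noncomputable section

/-! ### The visual boundary -/

/-- Geodesic rays, with the topology of uniform convergence on compact sets. -/
abbrev GeodRay (X : Type u) [MetricSpace X] : Type u := {r : C(ℝ≥0, X) // Isometry r}

/-- Two rays are asymptotic if they stay at bounded distance from each other. -/
def asymptoticSetoid (X : Type u) [MetricSpace X] : Setoid (GeodRay X) where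
  r r₁ r₂ := ∃ C : ℝ, ∀ t : ℝ≥0, dist (r₁.1 t) (r₂.1 t) ≤ C
  iseqv :=
    { refl := fun r => ⟨0, fun t => by simp⟩
      symm := fun ⟨C, h⟩ => ⟨C, fun t => by rw [dist_comm]; exact h t⟩
      trans := fun ⟨C, h⟩ ⟨C', h'⟩ =>
        ⟨C + C', fun t => (dist_triangle _ _ _).trans (add_le_add (h t) (h' t))⟩ }

/-- The points of the visual boundary `∂X`: asymptoty classes of geodesic rays. -/
def VisualBoundary (X : Type u) [MetricSpace X] : Type u := Quotient (asymptoticSetoid X)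

variable {X : Type u} [MetricSpace X]

/-- The point at infinity of a ray. -/
def GeodRay.endpoint (r : GeodRay X) : VisualBoundary X := Quotient.mk (asymptoticSetoid X) r

/-- The topology of `∂X` obtained from the rays issuing from the point `o` (in a complete CAT(0)
space each point of `∂X` is the endpoint of exactly one such ray). -/
@[reducible] def coneTopology (o : X) : TopologicalSpace (VisualBoundary X) :=
  TopologicalSpace.coinduced
    (fun r : {r : GeodRay X // r.1 0 = o} => GeodRay.endpoint r.1) inferInstance

/-- The action of an isometry of `X` on rays. -/
def GeodRay.map (g : X ≃ᵢ X) (r : GeodRay X) : GeodRay X :=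
  ⟨⟨fun t => g (r.1 t), g.continuous.comp r.1.continuous⟩, g.isometry.comp r.2⟩

/-- The action of an isometry of `X` on `∂X`. -/
def VisualBoundary.map (g : X ≃ᵢ X) : VisualBoundary X → VisualBoundary X :=
  Quotient.map' (s₁ := asymptoticSetoid X) (s₂ := asymptoticSetoid X) (GeodRay.map g) (by
    rintro r₁ r₂ ⟨C, h⟩
    exact ⟨C, fun t => (g.dist_eq _ _).trans_le (h t)⟩)

/-! ### Contracting geodesic lines -/

/-- Biinfinite geodesics, parametrized by arc length (hence oriented). -/
abbrev GeodLine (X : Type u) [MetricSpace X] : Type u := {γ : ℝ → X // Isometry γ}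

/-- `γ(∞)`. -/
def GeodLine.posEnd (γ : GeodLine X) : VisualBoundary X :=
  GeodRay.endpoint ⟨⟨fun t : ℝ≥0 => γ.1 (t : ℝ), γ.2.continuous.comp NNReal.continuous_coe⟩,
    γ.2.comp isometry_subtype_coe⟩

/-- `γ` with the reversed orientation. -/
def GeodLine.reverse (γ : GeodLine X) : GeodLine X :=
  ⟨fun t => γ.1 (-t), γ.2.comp (IsometryEquiv.neg ℝ).isometry⟩

/-- `γ(-∞)`. -/
def GeodLine.negEnd (γ : GeodLine X) : VisualBoundary X := γ.reverse.posEnd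

/-- `g ∘ γ`. -/
def GeodLine.map (g : X ≃ᵢ X) (γ : GeodLine X) : GeodLine X :=
  ⟨fun t => g (γ.1 t), g.isometry.comp γ.2⟩

/-- The points of `C` nearest to `p` (one point `π_C(p)`, if `X` is a complete CAT(0) space and `C`
is nonempty, closed and convex). -/
def nearestPoints (C : Set X) (p : X) : Set X := {q ∈ C | ∀ c ∈ C, dist p q ≤ dist p c}

/-- `γ` is `B`-contracting: the projection to `γ(ℝ)` of a closed metric ball disjoint from `γ(ℝ)`
has diameter at most `B`. -/
def GeodLine.IsContracting (B : ℝ) (γ : GeodLine X) : Prop :=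
  ∀ (p : X) (r : ℝ), Disjoint (Metric.closedBall p r) (range γ.1) →
    Metric.ediam (⋃ y ∈ Metric.closedBall p r, nearestPoints (range γ.1) y) ≤ ENNReal.ofReal B

/-- `γ` is a `B`-contracting geodesic connecting `α.1` to `α.2`. -/
def GeodLine.ContractingJoins (B : ℝ) (γ : GeodLine X)
    (α : VisualBoundary X × VisualBoundary X) : Prop :=
  γ.IsContracting B ∧ γ.negEnd = α.1 ∧ γ.posEnd = α.2

variable (X) in
/-- The space `𝒜(B)` of pairs of points of `∂X` connected by a `B`-contracting geodesic. -/
def ContractingPairs (B : ℝ) : Set (VisualBoundary X × VisualBoundary X) :=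
  {α | ∃ γ : GeodLine X, γ.ContractingJoins B α}

theorem GeodLine.reverse_reverse (γ : GeodLine X) : γ.reverse.reverse = γ :=
  Subtype.ext (funext fun t => congrArg γ.1 (neg_neg t))

theorem GeodLine.range_reverse (γ : GeodLine X) : range γ.reverse.1 = range γ.1 :=
  (Equiv.neg ℝ).surjective.range_comp γ.1

theorem GeodLine.ContractingJoins.reverse {B : ℝ} {γ : GeodLine X}
    {α : VisualBoundary X × VisualBoundary X} (h : γ.ContractingJoins B α) :
    γ.reverse.ContractingJoins B α.swap := by
  refine ⟨?_, ?_, h.2.1⟩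
  · intro p r hr
    rw [γ.range_reverse] at hr ⊢
    exact h.1 p r hr
  · rw [GeodLine.negEnd, γ.reverse_reverse]
    exact h.2.2

theorem GeodLine.ContractingJoins.map {B : ℝ} {γ : GeodLine X}
    {α : VisualBoundary X × VisualBoundary X} (h : γ.ContractingJoins B α) (g : X ≃ᵢ X) :
    (γ.map g).ContractingJoins B (VisualBoundary.map g α.1, VisualBoundary.map g α.2) := by
  have hrange : range (γ.map g).1 = g '' range γ.1 := range_comp g γ.1
  refine ⟨?_, ?_, ?_⟩
  · intro p r hr
    have hd : Disjoint (Metric.closedBall (g.symm p) r) (range γ.1) := by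
      rw [Set.disjoint_left] at hr ⊢
      intro y hy hyγ
      refine hr (a := g y) ?_ (by rw [hrange]; exact mem_image_of_mem g hyγ)
      rw [Metric.mem_closedBall] at hy ⊢
      rw [← g.symm.dist_eq]
      simpa using hy
    have hsub : (⋃ y ∈ Metric.closedBall p r, nearestPoints (range (γ.map g).1) y) ⊆
        g '' (⋃ y ∈ Metric.closedBall (g.symm p) r, nearestPoints (range γ.1) y) := by
      intro q hq
      simp only [mem_iUnion] at hq
      obtain ⟨y, hy, hq, hmin⟩ := hq
      rw [hrange] at hq hmin
      obtain ⟨q', hq', rfl⟩ := hq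
      refine mem_image_of_mem g ?_
      simp only [mem_iUnion]
      refine ⟨g.symm y, ?_, hq', fun c hc => ?_⟩
      · rw [Metric.mem_closedBall, g.symm.dist_eq]
        exact hy
      · have := hmin (g c) (mem_image_of_mem g hc)
        rw [← g.symm.dist_eq, ← g.symm.dist_eq y] at this
        simpa using this
    refine (Metric.ediam_mono hsub).trans ?_
    rw [g.isometry.ediam_image]
    exact h.1 _ _ hd
  · rw [← h.2.1]
    rfl
  · rw [← h.2.2]
    rfl

/-- The flip `ι : (ξ, η) ↦ (η, ξ)` of `𝒜(B)`. -/
def ContractingPairs.flip {B : ℝ} (α : ContractingPairs X B) : ContractingPairs X B :=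
  ⟨α.1.swap, let ⟨γ, h⟩ := α.2; ⟨γ.reverse, h.reverse⟩⟩

/-- The action of an isometry of `X` on `𝒜(B)`. -/
def ContractingPairs.map {B : ℝ} (g : X ≃ᵢ X) (α : ContractingPairs X B) : ContractingPairs X B :=
  ⟨(VisualBoundary.map g α.1.1, VisualBoundary.map g α.1.2),
    let ⟨γ, h⟩ := α.2; ⟨γ.map g, h.map g⟩⟩

/-! ### The function `τ_B` -/

/-- The parameter `t` such that `γ t` is the projection of `p` to `γ(ℝ)`. -/
def GeodLine.projParam (γ : GeodLine X) (p : X) : ℝ :=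
  Classical.epsilon fun t : ℝ => γ.1 t ∈ nearestPoints (range γ.1) p

/-- The interval `[a, b]` of the parameters at which `ζ` is within `6B + 2` of `ζ'(ℝ)`. -/
def fellowSet (B : ℝ) (ζ ζ' : GeodLine X) : Set ℝ :=
  {t | Metric.infDist (ζ.1 t) (range ζ'.1) ≤ 6 * B + 2}

/-- The left end `a` of the interval, possibly `-∞`. -/
def fellowLeft (B : ℝ) (ζ ζ' : GeodLine X) : EReal :=
  sInf ((fun t : ℝ => (t : EReal)) '' fellowSet B ζ ζ')

/-- The right end `b` of the interval, possibly `∞`. -/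
def fellowRight (B : ℝ) (ζ ζ' : GeodLine X) : EReal :=
  sSup ((fun t : ℝ => (t : EReal)) '' fellowSet B ζ ζ')

open Classical in
/-- The function of `z` whose minimum on a geodesic determines the projection of the point `ζ(e)` of
`X ∪ ∂X`: the distance from `ζ(e)` if `e` is finite, and the Busemann function at `ζ(e)`,
normalized at `ζ(0)`, if `e = ±∞`. -/
def distOrBusemann (ζ : GeodLine X) (e : EReal) (z : X) : ℝ :=
  if e = ⊤ then limUnder atTop fun u : ℝ => dist (ζ.1 u) z - dist (ζ.1 u) (ζ.1 0)
  else if e = ⊥ then limUnder atBot fun u : ℝ => dist (ζ.1 u) z - dist (ζ.1 u) (ζ.1 0)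
  else dist (ζ.1 e.toReal) z

/-- `s` is a point of `[-∞, ∞]` where `f` is minimal; `s = ±∞` means that `f` does not attain its
infimum and approaches it at `±∞`. -/
def IsMinParam (f : ℝ → ℝ) (s : EReal) : Prop :=
  (∃ t : ℝ, s = (t : EReal) ∧ ∀ u, f t ≤ f u) ∨
  (s = ⊤ ∧ ∀ t, ∀ᶠ u in atTop, f u < f t) ∨
  (s = ⊥ ∧ ∀ t, ∀ᶠ u in atBot, f u < f t)

/-- The projection of the point `ζ'(e)` of `X ∪ ∂X` to the geodesic `ζ` is `ζ(s)`. -/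
def ProjectsTo (ζ ζ' : GeodLine X) (e s : EReal) : Prop :=
  IsMinParam (fun t => distOrBusemann ζ' e (ζ.1 t)) s

/-- The projections to `ζ` of the initial and the terminal point of the subarc `[a', b']` of `ζ'`
are `ζ(s)` and `ζ(t)` with `s < t`. -/
def CoherentlyOriented (B : ℝ) (ζ ζ' : GeodLine X) : Prop :=
  ∃ s t : EReal, ProjectsTo ζ ζ' (fellowLeft B ζ' ζ) s ∧ ProjectsTo ζ ζ' (fellowRight B ζ' ζ) t ∧
    s < t

open Classical in
/-- The distance from `p` to `ζ(e)`, infinite if `e = ±∞`. -/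
def distToParam (ζ : GeodLine X) (p : X) (e : EReal) : ℝ≥0∞ :=
  if e = ⊤ ∨ e = ⊥ then ⊤ else ENNReal.ofReal (dist p (ζ.1 e.toReal))

/-- `min {d(π_ζ(x), ζ(a)), d(π_ζ(x), ζ(b))}`. -/
def endDist (B : ℝ) (x : X) (ζ ζ' : GeodLine X) : ℝ≥0∞ :=
  min (distToParam ζ (ζ.1 (ζ.projParam x)) (fellowLeft B ζ ζ'))
    (distToParam ζ (ζ.1 (ζ.projParam x)) (fellowRight B ζ ζ'))

open Classical in
/-- `τ_B(x, ζ₁, ζ₂)` for oriented geodesic lines. The value is finite unless the two lines have the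
same endpoints `ζ₁(-∞) = ζ₂(-∞)` and `ζ₁(∞) = ζ₂(∞)`. -/
def tauLine (B : ℝ) (x : X) (ζ₁ ζ₂ : GeodLine X) : ℝ≥0∞ :=
  if (fellowSet B ζ₁ ζ₂).Nonempty ∧ (fellowSet B ζ₂ ζ₁).Nonempty ∧
      CoherentlyOriented B ζ₁ ζ₂ ∧ CoherentlyOriented B ζ₂ ζ₁ ∧
      ζ₁.projParam x ∈ fellowSet B ζ₁ ζ₂ ∧ ζ₂.projParam x ∈ fellowSet B ζ₂ ζ₁
  then min (endDist B x ζ₁ ζ₂) (endDist B x ζ₂ ζ₁)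
  else 0

/-- `τ_B(x, α₁, α₂)`: the infimum of `τ_B(x, ζ₁, ζ₂)` over all `B`-contracting geodesics `ζᵢ`
connecting the two components of `αᵢ`. -/
def tau (B : ℝ) (x : X) (α₁ α₂ : VisualBoundary X × VisualBoundary X) : ℝ≥0∞ :=
  ⨅ (ζ₁ : GeodLine X) (_ : ζ₁.ContractingJoins B α₁)
    (ζ₂ : GeodLine X) (_ : ζ₂.ContractingJoins B α₂), tauLine B x ζ₁ ζ₂

open Classical in
/-- `δ̃_x(α₁, α₂) = exp (-χ τ_B(x, α₁, α₂))` for `α₁ ≠ α₂`, and `δ̃_x(α, α) = 0`. -/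
def deltaTilde (B χ : ℝ) (x : X) (α₁ α₂ : ContractingPairs X B) : ℝ :=
  if α₁ = α₂ then 0 else Real.exp (-χ * (tau B x α₁.1 α₂.1).toReal)

end

/-! The point is that `τ_B` measures, up to an additive error linear in `B`, how long two
contracting lines fellow travel around the projections of `x`. In a `CAT(0)` space distances between
geodesics are convex and projections to lines are 1-Lipschitz. Moreover, a geodesic staying farther
than `6B + 1` from a `B`-contracting line has endpoint projections at most `6B` apart
(`abs_projParam_sub_le_of_far`). Hence a geodesic whose ends are within `K` of such a line is within
`6B + 2` of it except on end pieces of length about `3K + 2B` (`infDist_le_of_mem`).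

Consequently `τ_B ≥ T` with `T > 18B + 6` gives synchronous fellow travelling up to time `T` with
the uniform constant `37B + 13` (`fellow_of_le_tauLine`). Conversely, fellow travelling with any
constant `K` up to time `T` gives `τ_B ≥ T - O(K + B)` (`Fellow.le_tauLine`). Adding constants along
two pairs of lines yields `τ_B(α, η) ≥ min (τ_B(α, β)) (τ_B(β, η)) - 612 (B + 1)`
(`le_tau_of_le_tau`). Thus `deltaTilde` is a quasi-ultrametric with constant `e^{612 χ (B + 1)} = 1
+ χ'`.

The metric `δ_x` is the infimum of the sums of `deltaTilde` along chains. If `(1 + c)² ≤ 2`, halving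
a chain shows by induction that a quasi-ultrametric with constant `1 + c` loses at most the factor
`1 - 2c` (`ChainSum.mul_le`). The construction is functorial, so invariance under the flip and
isometries and the dependence on `x` follow from the same properties of `deltaTilde`.

For the topology, rays from `o` with the given endpoints are close for a long time exactly when
`τ_B` is large (`exists_le_tau_of_dist_rayTo_lt`, `exists_dist_rayTo_lt_of_le_tau`). Local
compactness holds because pointwise ultralimits of `B`-contracting lines are `B`-contracting
(`exists_eventually_le_tau`). -/

noncomputable section

section

variable {X : Type u} [MetricSpace X]

/-! ### Convexity in `CAT(0)` spaces -/

/-- `m` divides the segment from `a` to `b` in the ratio `t : 1 - t`. -/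
def Divides (t : ℝ) (a b m : X) : Prop :=
  dist a m = t * dist a b ∧ dist m b = (1 - t) * dist a b

/-- `c` is parametrized by arc length on `S`. -/
def GeodOn (c : ℝ → X) (S : Set ℝ) : Prop :=
  ∀ s ∈ S, ∀ t ∈ S, dist (c s) (c t) = |s - t|

theorem GeodOn.mono {c : ℝ → X} {S S' : Set ℝ} (h : GeodOn c S) (hS : S' ⊆ S) : GeodOn c S' :=
  fun s hs t ht => h s (hS hs) t (hS ht)

theorem GeodLine.dist_eq (γ : GeodLine X) (s t : ℝ) : dist (γ.1 s) (γ.1 t) = |s - t| := by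
  rw [γ.2.dist_eq, Real.dist_eq]

theorem GeodLine.geodOn (γ : GeodLine X) (S : Set ℝ) : GeodOn γ.1 S :=
  fun s _ t _ => γ.dist_eq s t

theorem GeodLine.geodOn_add (γ : GeodLine X) (p : ℝ) (S : Set ℝ) :
    GeodOn (fun t => γ.1 (p + t)) S :=
  fun s _ t _ => by rw [γ.dist_eq, add_sub_add_left_eq_sub]

theorem GeodOn.continuousOn {c : ℝ → X} {S : Set ℝ} (h : GeodOn c S) : ContinuousOn c S := by
  have : LipschitzOnWith 1 c S := LipschitzOnWith.of_dist_le_mul fun s hs t ht => by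
    rw [h s hs t ht, Real.dist_eq]; simp
  exact this.continuousOn

theorem GeodOn.divides {c : ℝ → X} {S : Set ℝ} (h : GeodOn c S) (hS : Convex ℝ S) {u v : ℝ}
    (hu : u ∈ S) (hv : v ∈ S) {t : ℝ} (ht : t ∈ Icc (0 : ℝ) 1) :
    Divides t (c u) (c v) (c ((1 - t) * u + t * v)) := by
  have hm : (1 - t) * u + t * v ∈ S := hS hu hv (by linarith [ht.2]) ht.1 (by ring)
  have h1 : (0 : ℝ) ≤ 1 - t := by linarith [ht.2]
  constructor
  · rw [h u hu _ hm, h u hu v hv, show u - ((1 - t) * u + t * v) = t * (u - v) by ring, abs_mul,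
      abs_of_nonneg ht.1]
  · rw [h _ hm v hv, h u hu v hv, show (1 - t) * u + t * v - v = (1 - t) * (u - v) by ring,
      abs_mul, abs_of_nonneg h1]

section CAT0

variable [IsCAT0 X]

theorem exists_divides (a b : X) {t : ℝ} (ht : t ∈ Icc (0 : ℝ) 1) : ∃ m, Divides t a b m := by
  obtain ⟨c, h0, h1, hc⟩ := IsCAT0.exists_geodesic a b
  have hd : (0 : ℝ) ≤ dist a b := dist_nonneg
  have := GeodOn.divides (S := Icc 0 (dist a b)) hc (convex_Icc _ _) (left_mem_Icc.2 hd)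
    (right_mem_Icc.2 hd) ht
  rw [h0, h1] at this
  exact ⟨_, this⟩

theorem Divides.comparison {t : ℝ} (ht : t ∈ Icc (0 : ℝ) 1) {a b m : X} (h : Divides t a b m)
    (p : X) :
    dist p m ^ 2 ≤ (1 - t) * dist p a ^ 2 + t * dist p b ^ 2 - t * (1 - t) * dist a b ^ 2 :=
  IsCAT0.comparison p a b m t ht h.1 h.2

/-- Two comparisons suffice: `m` against the side from `a` to `b'`, then `b'` against the side from
`a` to `b`. Substituting the second into the first leaves `t² d(b, b')²`. -/
theorem Divides.dist_le_of_common {t : ℝ} (ht : t ∈ Icc (0 : ℝ) 1) {a b b' m n : X}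
    (h : Divides t a b m) (h' : Divides t a b' n) : dist m n ≤ t * dist b b' := by
  have h1 := h'.comparison ht m
  have h2 := h.comparison ht b'
  rw [dist_comm m a, h.1] at h1
  rw [dist_comm b' m, dist_comm b' a, dist_comm b' b] at h2
  have h3 := mul_le_mul_of_nonneg_left h2 ht.1
  refine abs_le_of_sq_le_sq' ?_ (mul_nonneg ht.1 dist_nonneg) |>.2
  nlinarith

theorem Divides.dist_le {t : ℝ} (ht : t ∈ Icc (0 : ℝ) 1) {a b a' b' m m' : X}
    (h : Divides t a b m) (h' : Divides t a' b' m') :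
    dist m m' ≤ (1 - t) * dist a a' + t * dist b b' := by
  -- The diagonal from `a` to `b'` cuts the quadrilateral into two triangles, each with a common
  -- vertex.
  obtain ⟨n, hn⟩ := exists_divides a b' ht
  have h1 := h.dist_le_of_common ht hn
  have ht' : 1 - t ∈ Icc (0 : ℝ) 1 := ⟨by linarith [ht.2], by linarith [ht.1]⟩
  have hn' : Divides (1 - t) b' a n := by
    refine ⟨?_, ?_⟩
    · rw [dist_comm, hn.2, dist_comm a]
    · rw [dist_comm, hn.1, dist_comm a]; ring
  have hm' : Divides (1 - t) b' a' m' := by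
    refine ⟨?_, ?_⟩
    · rw [dist_comm, h'.2, dist_comm a']
    · rw [dist_comm, h'.1, dist_comm a']; ring
  have h2 := hn'.dist_le_of_common ht' hm'
  linarith [dist_triangle m n m']

/-- The distance between two geodesics is a convex function. -/
theorem GeodOn.convexOn_dist {c c' : ℝ → X} {S : Set ℝ} (hS : Convex ℝ S) (hc : GeodOn c S)
    (hc' : GeodOn c' S) : ConvexOn ℝ S fun t => dist (c t) (c' t) := by
  refine ⟨hS, fun u hu v hv a b ha hb hab => ?_⟩
  have hb' : b ∈ Icc (0 : ℝ) 1 := ⟨hb, by linarith⟩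
  obtain rfl : a = 1 - b := by linarith
  exact (hc.divides hS hu hv hb').dist_le hb' (hc'.divides hS hu hv hb')

/-- The sum of the squares of the diagonals of a quadrilateral is at most the sum of the squares of
the sides. -/
theorem diagonals_sq_le (a b c d : X) :
    dist a c ^ 2 + dist b d ^ 2 ≤ dist a b ^ 2 + dist b c ^ 2 + dist c d ^ 2 + dist d a ^ 2 := by
  -- Compare `b` and `d` with the midpoint of the diagonal from `a` to `c`, then use `d(b, d)² ≤ 2
  -- d(b, m)² + 2 d(d, m)²`.
  have ht : (1 / 2 : ℝ) ∈ Icc (0 : ℝ) 1 := by constructor <;> norm_num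
  obtain ⟨m, hm⟩ := exists_divides a c ht
  have h1 := hm.comparison ht b
  have h2 := hm.comparison ht d
  have h3 := dist_triangle_right b d m
  rw [dist_comm b a] at h1
  rw [dist_comm d c] at h2
  nlinarith [sq_nonneg (dist b m - dist d m), dist_nonneg (x := b) (y := d),
    dist_nonneg (x := b) (y := m), dist_nonneg (x := d) (y := m)]

end CAT0

/-! ### Projection to a geodesic line -/

theorem GeodLine.exists_nearest (γ : GeodLine X) (p : X) :
    ∃ t, γ.1 t ∈ nearestPoints (range γ.1) p := by
  have hlim : Tendsto (fun t => dist p (γ.1 t)) (cocompact ℝ) atTop := by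
    refine tendsto_atTop_mono (f := fun t => ‖t‖ - dist p (γ.1 0)) (fun t => ?_)
      (tendsto_atTop_add_const_right _ _ (tendsto_norm_cocompact_atTop))
    have := dist_triangle_left (γ.1 t) (γ.1 0) p
    rw [γ.dist_eq, sub_zero] at this
    rw [Real.norm_eq_abs]; linarith
  obtain ⟨t, ht⟩ := Continuous.exists_forall_le (f := fun t => dist p (γ.1 t))
    (continuous_const.dist γ.2.continuous) hlim
  exact ⟨t, mem_range_self t, by rintro _ ⟨u, rfl⟩; exact ht u⟩

theorem GeodLine.projParam_mem (γ : GeodLine X) (p : X) :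
    γ.1 (γ.projParam p) ∈ nearestPoints (range γ.1) p :=
  Classical.epsilon_spec (p := fun t : ℝ => γ.1 t ∈ nearestPoints (range γ.1) p)
    (γ.exists_nearest p)

theorem GeodLine.dist_projParam_le (γ : GeodLine X) (p : X) (t : ℝ) :
    dist p (γ.1 (γ.projParam p)) ≤ dist p (γ.1 t) :=
  (γ.projParam_mem p).2 _ (mem_range_self t)

theorem GeodLine.infDist_eq (γ : GeodLine X) (p : X) :
    Metric.infDist p (range γ.1) = dist p (γ.1 (γ.projParam p)) := by
  refine le_antisymm (Metric.infDist_le_dist_of_mem (mem_range_self _)) ?_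
  refine (Metric.le_infDist (range_nonempty _)).2 ?_
  rintro _ ⟨t, rfl⟩
  exact γ.dist_projParam_le p t

theorem GeodLine.infDist_le (γ : GeodLine X) (p : X) (t : ℝ) :
    Metric.infDist p (range γ.1) ≤ dist p (γ.1 t) :=
  Metric.infDist_le_dist_of_mem (mem_range_self _)

theorem infDist_le_infDist_add (S : Set X) (p q : X) :
    Metric.infDist p S ≤ Metric.infDist q S + dist p q :=
  Metric.infDist_le_infDist_add_dist

/-- Strictness of `r < infDist` makes the closed ball disjoint from the line, so the definition of
contraction applies. -/
theorem GeodLine.IsContracting.abs_projParam_sub_le_of_mem_ball {B : ℝ} (hB : 0 ≤ B)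
    {γ : GeodLine X} (h : γ.IsContracting B) {p y z : X} {r : ℝ}
    (hr : r < Metric.infDist p (range γ.1)) (hy : dist p y ≤ r) (hz : dist p z ≤ r) :
    |γ.projParam y - γ.projParam z| ≤ B := by
  have hd : Disjoint (Metric.closedBall p r) (range γ.1) := by
    rw [Set.disjoint_left]
    rintro z hz ⟨t, rfl⟩
    rw [Metric.mem_closedBall, dist_comm] at hz
    linarith [γ.infDist_le p t]
  have h1 := h p r hd
  have mem : ∀ z ∈ Metric.closedBall p r, γ.1 (γ.projParam z) ∈
      ⋃ y ∈ Metric.closedBall p r, nearestPoints (range γ.1) y := fun z hz =>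
    mem_biUnion hz (γ.projParam_mem z)
  have h2 := (Metric.edist_le_ediam_of_mem (mem y (by rwa [Metric.mem_closedBall, dist_comm]))
    (mem z (by rwa [Metric.mem_closedBall, dist_comm]))).trans h1
  rw [edist_dist, ENNReal.ofReal_le_ofReal_iff hB, γ.dist_eq] at h2
  exact h2

theorem GeodLine.IsContracting.abs_projParam_sub_le {B : ℝ} (hB : 0 ≤ B) {γ : GeodLine X}
    (h : γ.IsContracting B) {p y : X} {r : ℝ} (hr : r < Metric.infDist p (range γ.1))
    (hy : dist p y ≤ r) : |γ.projParam p - γ.projParam y| ≤ B :=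
  h.abs_projParam_sub_le_of_mem_ball hB hr (by rw [dist_self]; exact dist_nonneg.trans hy) hy

/-- The projection to a line moves by at least `dist` minus the distances to the line. -/
theorem GeodLine.dist_le_abs_projParam_sub (γ : GeodLine X) (p q : X) :
    dist p q ≤ Metric.infDist p (range γ.1) + |γ.projParam p - γ.projParam q| +
      Metric.infDist q (range γ.1) := by
  have h := dist_triangle4 p (γ.1 (γ.projParam p)) (γ.1 (γ.projParam q)) q
  rw [γ.dist_eq, dist_comm (γ.1 _) q] at h
  rwa [γ.infDist_eq, γ.infDist_eq]

variable [IsCAT0 X]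

/-- The angle at a nearest point is at least a right angle. Minimality is compared with points
dividing the segment in ratio `s : 1 - s`; after cancelling `s`, the claim is the limit `s → 0`. -/
theorem GeodLine.sq_add_sq_le_of_minimal (γ : GeodLine X) {p : X} {t : ℝ}
    (h : ∀ u, dist p (γ.1 t) ≤ dist p (γ.1 u)) (u : ℝ) :
    dist p (γ.1 t) ^ 2 + (u - t) ^ 2 ≤ dist p (γ.1 u) ^ 2 := by
  by_contra! hlt
  set a := dist p (γ.1 t)
  set b := dist p (γ.1 u)
  have key : ∀ s ∈ Ioc (0 : ℝ) 1, a ^ 2 ≤ b ^ 2 - (1 - s) * (u - t) ^ 2 := by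
    intro s hs
    have hs' : s ∈ Icc (0 : ℝ) 1 := ⟨hs.1.le, hs.2⟩
    have h1 := ((γ.geodOn univ).divides convex_univ (mem_univ t) (mem_univ u) hs').comparison hs' p
    have h2 : a ^ 2 ≤ _ := pow_le_pow_left₀ dist_nonneg (h ((1 - s) * t + s * u)) 2
    rw [γ.dist_eq, sq_abs] at h1
    have h3 : s * a ^ 2 ≤ s * (b ^ 2 - (1 - s) * (u - t) ^ 2) := by
      have : (t - u) ^ 2 = (u - t) ^ 2 := by ring
      rw [this] at h1
      linarith
    exact le_of_mul_le_mul_left h3 hs.1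
  have hε : 0 < a ^ 2 + (u - t) ^ 2 - b ^ 2 := by linarith
  set ε := a ^ 2 + (u - t) ^ 2 - b ^ 2
  -- Instead of a limit, one explicit `s` small enough that `s (u - t)² < ε`.
  have hd : 0 < (u - t) ^ 2 + ε + 1 := by positivity
  have hq : 0 ≤ ε / ((u - t) ^ 2 + ε + 1) / 2 := by positivity
  have hs : ε / ((u - t) ^ 2 + ε + 1) / 2 ∈ Ioc (0 : ℝ) 1 := by
    refine ⟨by positivity, ?_⟩
    rw [div_div, div_le_one (by positivity)]
    nlinarith [sq_nonneg (u - t)]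
  have h4 := key _ hs
  have h5 : ε / ((u - t) ^ 2 + ε + 1) / 2 * (u - t) ^ 2 < ε := by
    rw [div_div, div_mul_eq_mul_div, div_lt_iff₀ (by positivity)]
    nlinarith [sq_nonneg (u - t)]
  have : ε = a ^ 2 + (u - t) ^ 2 - b ^ 2 := rfl
  linarith

theorem GeodLine.sq_add_sq_le (γ : GeodLine X) (p : X) (u : ℝ) :
    dist p (γ.1 (γ.projParam p)) ^ 2 + (u - γ.projParam p) ^ 2 ≤ dist p (γ.1 u) ^ 2 :=
  γ.sq_add_sq_le_of_minimal (γ.dist_projParam_le p) u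

theorem GeodLine.projParam_eq (γ : GeodLine X) {p : X} {t : ℝ}
    (h : ∀ u, dist p (γ.1 t) ≤ dist p (γ.1 u)) : γ.projParam p = t := by
  have h1 := γ.sq_add_sq_le_of_minimal h (γ.projParam p)
  have h2 := pow_le_pow_left₀ dist_nonneg (γ.dist_projParam_le p t) 2
  have h3 : (γ.projParam p - t) ^ 2 ≤ 0 := by linarith
  have := pow_eq_zero_iff (two_ne_zero) |>.1 (le_antisymm h3 (sq_nonneg _))
  linarith

theorem GeodLine.projParam_apply (γ : GeodLine X) (t : ℝ) : γ.projParam (γ.1 t) = t :=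
  γ.projParam_eq fun u => by rw [dist_self]; exact dist_nonneg

/-- The projection to a line does not increase distances. -/
theorem GeodLine.abs_projParam_sub_le (γ : GeodLine X) (p q : X) :
    |γ.projParam p - γ.projParam q| ≤ dist p q := by
  -- The points `p`, `q` and their feet form a quadrilateral. These two right-angle inequalities
  -- bound its diagonals below, and `diagonals_sq_le` bounds them above.
  have h1 := γ.sq_add_sq_le p (γ.projParam q)
  have h2 := γ.sq_add_sq_le q (γ.projParam p)
  have h3 := diagonals_sq_le p (γ.1 (γ.projParam p)) (γ.1 (γ.projParam q)) q
  rw [γ.dist_eq, sq_abs, dist_comm _ q, dist_comm (γ.1 _) q, dist_comm q p] at h3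
  refine abs_le_of_sq_le_sq ?_ dist_nonneg
  nlinarith

theorem GeodLine.continuous_projParam (γ : GeodLine X) : Continuous γ.projParam := by
  have : LipschitzWith 1 γ.projParam := LipschitzWith.of_dist_le_mul fun p q => by
    rw [Real.dist_eq, NNReal.coe_one, one_mul]; exact γ.abs_projParam_sub_le p q
  exact this.continuous

theorem GeodOn.convexOn_infDist {c : ℝ → X} {S : Set ℝ} (hS : Convex ℝ S) (hc : GeodOn c S)
    (γ : GeodLine X) : ConvexOn ℝ S fun t => Metric.infDist (c t) (range γ.1) := by
  refine ⟨hS, fun u hu v hv a b ha hb hab => ?_⟩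
  have hb' : b ∈ Icc (0 : ℝ) 1 := ⟨hb, by linarith⟩
  obtain rfl : a = 1 - b := by linarith
  have h1 := (hc.divides hS hu hv hb').dist_le hb'
    ((γ.geodOn univ).divides convex_univ (mem_univ (γ.projParam (c u)))
      (mem_univ (γ.projParam (c v))) hb')
  rw [← γ.infDist_eq, ← γ.infDist_eq] at h1
  exact (γ.infDist_le _ _).trans h1

end

section

variable {X : Type u} [MetricSpace X]

/-! ### Geodesics and contracting lines -/

/-- Cut the arc into `n` pieces of length at most `D`; each lies in a ball missing the line, so it
moves the projection by at most `B`. -/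
theorem GeodLine.IsContracting.abs_projParam_sub_le_nat {B : ℝ} (hB : 0 ≤ B) {γ : GeodLine X}
    (h : γ.IsContracting B) {c : ℝ → X} {D : ℝ} (hD : 0 < D) {b : ℝ} (n : ℕ) :
    ∀ a ≤ b, GeodOn c (Icc a b) → (∀ t ∈ Icc a b, D < Metric.infDist (c t) (range γ.1)) →
      b - a ≤ n * D → |γ.projParam (c a) - γ.projParam (c b)| ≤ n * B := by
  induction n with
  | zero =>
    intro a hab _ _ hn
    obtain rfl : a = b := by
      rw [Nat.cast_zero, zero_mul] at hn
      linarith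
    simp
  | succ n ih =>
    intro a hab hc hf hn
    push_cast at hn ⊢
    have hnB : 0 ≤ n * B := by positivity
    by_cases hD' : b - a ≤ D
    · have := h.abs_projParam_sub_le hB (hf a (left_mem_Icc.2 hab)) (y := c b) (by
        rw [hc a (left_mem_Icc.2 hab) b (right_mem_Icc.2 hab), abs_sub_comm,
          abs_of_nonneg (by linarith)]
        exact hD')
      linarith
    · push Not at hD'
      have hm : a + D ∈ Icc a b := ⟨by linarith, by linarith⟩
      have hsub : Icc (a + D) b ⊆ Icc a b := Icc_subset_Icc_left hm.1
      have h1 := h.abs_projParam_sub_le hB (hf a (left_mem_Icc.2 hab)) (y := c (a + D)) (by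
        rw [hc a (left_mem_Icc.2 hab) _ hm, sub_add_cancel_left, abs_neg, abs_of_pos hD])
      have h2 := ih (a + D) hm.2 (hc.mono hsub) (fun t ht => hf t (hsub ht)) (by linarith)
      have := abs_sub_le (γ.projParam (c a)) (γ.projParam (c (a + D))) (γ.projParam (c b))
      linarith

theorem GeodLine.IsContracting.abs_projParam_sub_le_mul {B : ℝ} (hB : 0 ≤ B) {γ : GeodLine X}
    (h : γ.IsContracting B) {c : ℝ → X} {D : ℝ} (hD : 0 < D) {a b : ℝ} (hab : a ≤ b)
    (hc : GeodOn c (Icc a b)) (hf : ∀ t ∈ Icc a b, D < Metric.infDist (c t) (range γ.1)) :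
    |γ.projParam (c a) - γ.projParam (c b)| ≤ B * ((b - a) / D + 1) := by
  have h0 : 0 ≤ (b - a) / D := div_nonneg (by linarith) hD.le
  have h1 := h.abs_projParam_sub_le_nat hB hD ⌈(b - a) / D⌉₊ a hab hc hf
    ((div_le_iff₀ hD).1 (Nat.le_ceil _))
  have h2 := (Nat.ceil_lt_add_one h0).le
  nlinarith

/-- The projection to a contracting line of a geodesic far from the line is small. -/
theorem GeodLine.IsContracting.abs_projParam_sub_le_of_far {B : ℝ} (hB : 0 < B) {γ : GeodLine X}
    (h : γ.IsContracting B) {c : ℝ → X} {a b : ℝ} (hab : a ≤ b) (hc : GeodOn c (Icc a b))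
    (hf : ∀ t ∈ Icc a b, 6 * B + 1 < Metric.infDist (c t) (range γ.1)) :
    |γ.projParam (c a) - γ.projParam (c b)| ≤ 6 * B := by
  have ha := left_mem_Icc.2 hab
  have hb := right_mem_Icc.2 hab
  have hfa := hf a ha
  have hfb := hf b hb
  have hl := γ.dist_le_abs_projParam_sub (c a) (c b)
  rw [hc a ha b hb, abs_sub_comm a, abs_of_nonneg (sub_nonneg.2 hab)] at hl
  set fa := Metric.infDist (c a) (range γ.1)
  set fb := Metric.infDist (c b) (range γ.1)
  set w := |γ.projParam (c a) - γ.projParam (c b)|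
  set D := 6 * B + 1
  have hD : D = 6 * B + 1 := rfl
  have hr : fa - D < fa := by linarith
  have hr' : fb - D < fb := by linarith
  -- The balls of radii `fa - D` and `fb - D` about the endpoints miss the line. If they cover the
  -- arc, the projection moves by at most `2B`; otherwise a middle arc remains.
  by_cases hcase : b - a ≤ (fa - D) + (fb - D)
  · have hm : a + min (fa - D) (b - a) ∈ Icc a b :=
      ⟨by linarith [(le_min (by linarith) (by linarith) : (0 : ℝ) ≤ min (fa - D) (b - a))],
        by linarith [min_le_right (fa - D) (b - a)]⟩
    have h1 := h.abs_projParam_sub_le hB.le hr (y := c (a + min (fa - D) (b - a))) (by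
      rw [hc a ha _ hm, sub_add_cancel_left, abs_neg, abs_of_nonneg (by linarith [hm.1])]
      exact min_le_left _ _)
    have h2 := h.abs_projParam_sub_le hB.le hr' (y := c (a + min (fa - D) (b - a))) (by
      rw [hc b hb _ hm, abs_of_nonneg (by linarith [hm.2])]
      rcases min_cases (fa - D) (b - a) with h | h <;> rw [h.1] <;> linarith)
    have := abs_sub_le (γ.projParam (c a)) (γ.projParam (c (a + min (fa - D) (b - a))))
      (γ.projParam (c b))
    rw [abs_sub_comm] at h2
    linarith
  · push Not at hcase
    have hm1 : a + (fa - D) ∈ Icc a b := ⟨by linarith, by linarith⟩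
    have hm2 : b - (fb - D) ∈ Icc a b := ⟨by linarith, by linarith⟩
    have hsub : Icc (a + (fa - D)) (b - (fb - D)) ⊆ Icc a b := Icc_subset_Icc hm1.1 hm2.2
    have h1 := h.abs_projParam_sub_le hB.le hr (y := c (a + (fa - D))) (by
      rw [hc a ha _ hm1, sub_add_cancel_left, abs_neg, abs_of_nonneg (by linarith)])
    have h2 := h.abs_projParam_sub_le hB.le hr' (y := c (b - (fb - D))) (by
      rw [hc b hb _ hm2, sub_sub_cancel, abs_of_nonneg (by linarith)])
    have h3 := h.abs_projParam_sub_le_mul hB.le (D := D) (by linarith) (a := a + (fa - D))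
      (b := b - (fb - D)) (by linarith) (hc.mono hsub) fun t ht => hf t (hsub ht)
    have h4 := abs_sub_le (γ.projParam (c a)) (γ.projParam (c (a + (fa - D))))
      (γ.projParam (c b))
    have h5 := abs_sub_le (γ.projParam (c (a + (fa - D)))) (γ.projParam (c (b - (fb - D))))
      (γ.projParam (c b))
    rw [abs_sub_comm] at h2
    -- Since `b - a ≤ fa + w + fb`, the middle arc has length at most `w + 2D`.
    have h6 : B * ((b - (fb - D) - (a + (fa - D))) / D + 1) ≤ B * (w / D + 3) := by
      refine mul_le_mul_of_nonneg_left ?_ hB.le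
      have : (b - (fb - D) - (a + (fa - D))) / D ≤ (w + 2 * D) / D :=
        div_le_div_of_nonneg_right (by linarith) (by linarith)
      have h7 : (w + 2 * D) / D = w / D + 2 := by
        rw [add_div, mul_div_assoc, div_self (by linarith), mul_one]
      linarith
    -- Here `D ≥ 6B` is used: altogether `w ≤ 5B + w / 6`, that is `w ≤ 6B`.
    have h8 : B * (w / D) ≤ w / 6 := by
      rw [← mul_div_assoc, div_le_div_iff₀ (by linarith) (by norm_num)]
      nlinarith [abs_nonneg (γ.projParam (c a) - γ.projParam (c b))]
    linarith

/-- A geodesic far from a contracting line whose endpoints are not very far from it is short. -/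
theorem GeodLine.IsContracting.length_le_of_far {B : ℝ} (hB : 0 < B) {γ : GeodLine X}
    (h : γ.IsContracting B) {c : ℝ → X} {a b K : ℝ} (hab : a ≤ b) (hc : GeodOn c (Icc a b))
    (hf : ∀ t ∈ Icc a b, 6 * B + 2 < Metric.infDist (c t) (range γ.1))
    (ha : Metric.infDist (c a) (range γ.1) ≤ K) (hb : Metric.infDist (c b) (range γ.1) ≤ K) :
    b - a ≤ 3 * K + 2 * B := by
  have h1 := h.abs_projParam_sub_le_mul hB.le (by linarith) hab hc hf
  have hl := γ.dist_le_abs_projParam_sub (c a) (c b)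
  rw [hc a (left_mem_Icc.2 hab) b (right_mem_Icc.2 hab), abs_sub_comm a,
    abs_of_nonneg (sub_nonneg.2 hab)] at hl
  -- Hence `b - a ≤ 2K + B + (b - a) / 6`, which is stronger than the claim.
  have h2 : B * ((b - a) / (6 * B + 2)) ≤ (b - a) / 6 := by
    rw [← mul_div_assoc, div_le_div_iff₀ (by linarith) (by norm_num)]
    nlinarith
  have hK : 0 ≤ K := Metric.infDist_nonneg.trans ha
  linarith

/-- A geodesic whose endpoints have projections far from each other comes close to the line. -/
theorem GeodLine.IsContracting.exists_close {B : ℝ} (hB : 0 < B) {γ : GeodLine X}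
    (h : γ.IsContracting B) {c : ℝ → X} {a b : ℝ} (hab : a ≤ b) (hc : GeodOn c (Icc a b))
    (hlt : 6 * B < |γ.projParam (c a) - γ.projParam (c b)|) :
    ∃ t ∈ Icc a b, Metric.infDist (c t) (range γ.1) ≤ 6 * B + 1 := by
  by_contra! hcon
  exact absurd (h.abs_projParam_sub_le_of_far hB hab hc hcon) (not_le.2 hlt)

variable [IsCAT0 X]

/-- A geodesic with both endpoints not very far from a contracting line is close to the line, except
possibly near its endpoints. -/
theorem GeodLine.IsContracting.infDist_le_of_mem {B : ℝ} (hB : 0 < B) {γ : GeodLine X}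
    (h : γ.IsContracting B) {c : ℝ → X} {u v K : ℝ} (hc : GeodOn c (Icc u v))
    (hu : Metric.infDist (c u) (range γ.1) ≤ K) (hv : Metric.infDist (c v) (range γ.1) ≤ K)
    {t : ℝ} (ht : t ∈ Icc (u + (3 * K + 2 * B + 1)) (v - (3 * K + 2 * B + 1))) :
    Metric.infDist (c t) (range γ.1) ≤ 6 * B + 2 := by
  have hK : 0 ≤ K := Metric.infDist_nonneg.trans hu
  have hconv := hc.convexOn_infDist (convex_Icc u v) γ
  have hut : u ≤ t := by linarith [ht.1]
  have htv : t ≤ v := by linarith [ht.2]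
  have htK : Metric.infDist (c t) (range γ.1) ≤ K := by
    have := hconv.le_max_of_mem_Icc (left_mem_Icc.2 (hut.trans htv))
      (right_mem_Icc.2 (hut.trans htv)) ⟨hut, htv⟩
    exact this.trans (max_le hu hv)
  by_contra! hlt
  -- By convexity the times of closeness form an interval; as it misses `t`, one of the two sides of
  -- `t` consists of far times only, and that side is too long.
  have hcase : (∀ s ∈ Icc u t, 6 * B + 2 < Metric.infDist (c s) (range γ.1)) ∨
      ∀ s ∈ Icc t v, 6 * B + 2 < Metric.infDist (c s) (range γ.1) := by
    by_contra! hcon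
    obtain ⟨⟨s, hs, hs'⟩, r, hr, hr'⟩ := hcon
    have := hconv.le_max_of_mem_Icc (x := s) (y := r) (z := t) ⟨hs.1, hs.2.trans htv⟩
      ⟨hut.trans hr.1, hr.2⟩ ⟨hs.2, hr.1⟩
    exact absurd (this.trans (max_le hs' hr')) (not_le.2 hlt)
  rcases hcase with h1 | h1
  · have := h.length_le_of_far hB hut (hc.mono (Icc_subset_Icc_right htv)) h1 hu htK
    linarith [ht.1]
  · have := h.length_le_of_far hB htv (hc.mono (Icc_subset_Icc_left hut)) h1 htK hv
    linarith [ht.2]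

/-- A geodesic stays far from a contracting line only while its projection is almost constant: first
time of closeness. -/
theorem GeodLine.IsContracting.exists_first_close {B : ℝ} (hB : 0 < B) {γ : GeodLine X}
    (h : γ.IsContracting B) {c : ℝ → X} {a b : ℝ} (hc : GeodOn c (Icc a b))
    (hne : ∃ t ∈ Icc a b, Metric.infDist (c t) (range γ.1) ≤ 6 * B + 1) :
    ∃ t ∈ Icc a b, Metric.infDist (c t) (range γ.1) ≤ 6 * B + 1 ∧
      |γ.projParam (c a) - γ.projParam (c t)| ≤ 6 * B := by
  have hcont : ContinuousOn (fun t => Metric.infDist (c t) (range γ.1)) (Icc a b) :=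
    (Metric.continuous_infDist_pt _).comp_continuousOn hc.continuousOn
  have hclosed : IsCompact (Icc a b ∩ (fun t => Metric.infDist (c t) (range γ.1)) ⁻¹'
      Iic (6 * B + 1)) :=
    isCompact_Icc.of_isClosed_subset (hcont.preimage_isClosed_of_isClosed isClosed_Icc isClosed_Iic)
      inter_subset_left
  obtain ⟨t₀, ⟨ht₀, hle⟩, hmin⟩ := hclosed.exists_isLeast hne
  refine ⟨t₀, ht₀, hle, ?_⟩
  rcases ht₀.1.eq_or_lt with rfl | hlt
  · rw [sub_self, abs_zero]; linarith
  -- The arc is far only strictly before `t₀`, so the estimate is applied up to `t₀ - ε` and the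
  -- rest costs at most `ε`.
  refine le_of_forall_pos_le_add fun ε hε => ?_
  have hs : max a (t₀ - ε) < t₀ := max_lt hlt (by linarith)
  have hsub : Icc a (max a (t₀ - ε)) ⊆ Icc a b := Icc_subset_Icc_right (hs.le.trans ht₀.2)
  have h1 := h.abs_projParam_sub_le_of_far hB (le_max_left a (t₀ - ε)) (hc.mono hsub)
    fun t ht => by
      by_contra! hcon
      exact absurd (hmin ⟨hsub ht, hcon⟩) (not_le.2 (ht.2.trans_lt hs))
  have h2 := γ.abs_projParam_sub_le (c (max a (t₀ - ε))) (c t₀)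
  rw [hc _ ⟨le_max_left _ _, hs.le.trans ht₀.2⟩ _ ht₀, abs_sub_comm (max a (t₀ - ε)),
    abs_of_pos (sub_pos.2 hs)] at h2
  have := abs_sub_le (γ.projParam (c a)) (γ.projParam (c (max a (t₀ - ε)))) (γ.projParam (c t₀))
  linarith [le_max_right a (t₀ - ε)]

theorem GeodLine.IsContracting.exists_last_close {B : ℝ} (hB : 0 < B) {γ : GeodLine X}
    (h : γ.IsContracting B) {c : ℝ → X} {a b : ℝ} (hc : GeodOn c (Icc a b))
    (hne : ∃ t ∈ Icc a b, Metric.infDist (c t) (range γ.1) ≤ 6 * B + 1) :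
    ∃ t ∈ Icc a b, Metric.infDist (c t) (range γ.1) ≤ 6 * B + 1 ∧
      |γ.projParam (c t) - γ.projParam (c b)| ≤ 6 * B := by
  have hc' : GeodOn (fun t => c (-t)) (Icc (-b) (-a)) := fun s hs t ht => by
    rw [hc _ ⟨by linarith [hs.2], by linarith [hs.1]⟩ _ ⟨by linarith [ht.2], by linarith [ht.1]⟩,
      abs_sub_comm]
    congr 1; ring
  obtain ⟨t, ht, h1, h2⟩ := h.exists_first_close hB hc' (by
    obtain ⟨t, ht, h1⟩ := hne
    exact ⟨-t, ⟨by linarith [ht.2], by linarith [ht.1]⟩, by rwa [neg_neg]⟩)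
  rw [neg_neg, abs_sub_comm] at h2
  exact ⟨-t, ⟨by linarith [ht.2], by linarith [ht.1]⟩, h1, h2⟩

end

section

variable {X : Type u} [MetricSpace X]

/-! ### Reversal of lines -/

theorem GeodLine.reverse_apply (γ : GeodLine X) (t : ℝ) : γ.reverse.1 t = γ.1 (-t) := rfl

theorem fellowSet_reverse_left (B : ℝ) (ζ ζ' : GeodLine X) :
    fellowSet B ζ.reverse ζ' = Neg.neg ⁻¹' fellowSet B ζ ζ' := rfl

theorem fellowSet_reverse_right (B : ℝ) (ζ ζ' : GeodLine X) :
    fellowSet B ζ ζ'.reverse = fellowSet B ζ ζ' := by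
  unfold fellowSet
  rw [ζ'.range_reverse]

theorem EReal.sSup_neg_image (S : Set ℝ) :
    sSup ((fun t : ℝ => (t : EReal)) '' (Neg.neg ⁻¹' S)) =
      -sInf ((fun t : ℝ => (t : EReal)) '' S) := by
  apply le_antisymm
  · refine sSup_le ?_
    rintro _ ⟨t, ht, rfl⟩
    rw [EReal.le_neg]
    exact sInf_le ⟨-t, ht, EReal.coe_neg t⟩
  · rw [EReal.neg_le]
    refine le_sInf ?_
    rintro _ ⟨t, ht, rfl⟩
    rw [EReal.neg_le]
    exact le_sSup ⟨-t, by simpa using ht, EReal.coe_neg t⟩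

theorem fellowRight_reverse_left (B : ℝ) (ζ ζ' : GeodLine X) :
    fellowRight B ζ.reverse ζ' = -fellowLeft B ζ ζ' :=
  EReal.sSup_neg_image (fellowSet B ζ ζ')

theorem fellowLeft_reverse_left (B : ℝ) (ζ ζ' : GeodLine X) :
    fellowLeft B ζ.reverse ζ' = -fellowRight B ζ ζ' := by
  have := fellowRight_reverse_left B ζ.reverse ζ'
  rw [ζ.reverse_reverse] at this
  rw [this, neg_neg]

theorem fellowRight_reverse_right (B : ℝ) (ζ ζ' : GeodLine X) :
    fellowRight B ζ ζ'.reverse = fellowRight B ζ ζ' := by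
  rw [fellowRight, fellowRight, fellowSet_reverse_right]

theorem fellowLeft_reverse_right (B : ℝ) (ζ ζ' : GeodLine X) :
    fellowLeft B ζ ζ'.reverse = fellowLeft B ζ ζ' := by
  rw [fellowLeft, fellowLeft, fellowSet_reverse_right]

theorem distOrBusemann_reverse (ζ : GeodLine X) (e : EReal) (z : X) :
    distOrBusemann ζ.reverse e z = distOrBusemann ζ (-e) z := by
  unfold distOrBusemann
  have h0 : ζ.reverse.1 0 = ζ.1 0 := congrArg ζ.1 neg_zero
  have htop : (limUnder atTop fun u : ℝ => dist (ζ.reverse.1 u) z - dist (ζ.reverse.1 u)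
      (ζ.reverse.1 0)) = limUnder atBot fun u : ℝ => dist (ζ.1 u) z - dist (ζ.1 u) (ζ.1 0) := by
    rw [h0, limUnder, limUnder, ← map_neg_atTop, Filter.map_map]
    rfl
  have hbot : (limUnder atBot fun u : ℝ => dist (ζ.reverse.1 u) z - dist (ζ.reverse.1 u)
      (ζ.reverse.1 0)) = limUnder atTop fun u : ℝ => dist (ζ.1 u) z - dist (ζ.1 u) (ζ.1 0) := by
    rw [h0, limUnder, limUnder, ← map_neg_atBot, Filter.map_map]
    rfl
  rw [htop, hbot]
  induction e with
  | top => simp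
  | bot => simp
  | coe r =>
    have h1 : -(r : EReal) ≠ ⊤ := EReal.coe_ne_top (-r)
    have h2 : -(r : EReal) ≠ ⊥ := EReal.coe_ne_bot (-r)
    rw [if_neg (EReal.coe_ne_top r), if_neg (EReal.coe_ne_bot r), if_neg h1, if_neg h2,
      ζ.reverse_apply, EReal.toReal_neg_eq]

theorem IsMinParam.comp_neg {f : ℝ → ℝ} {s : EReal} (h : IsMinParam f s) :
    IsMinParam (fun t => f (-t)) (-s) := by
  rcases h with ⟨t, rfl, ht⟩ | ⟨rfl, ht⟩ | ⟨rfl, ht⟩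
  · exact Or.inl ⟨-t, (EReal.coe_neg t).symm, fun u => by
      change f (- -t) ≤ f (-u)
      rw [neg_neg]
      exact ht _⟩
  · refine Or.inr (Or.inr ⟨EReal.neg_top, fun t => ?_⟩)
    exact tendsto_neg_atBot_atTop.eventually (ht (-t))
  · refine Or.inr (Or.inl ⟨EReal.neg_bot, fun t => ?_⟩)
    exact tendsto_neg_atTop_atBot.eventually (ht (-t))

theorem projectsTo_reverse_left {ζ ζ' : GeodLine X} {e s : EReal} :
    ProjectsTo ζ.reverse ζ' e s ↔ ProjectsTo ζ ζ' e (-s) := by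
  constructor <;> intro h
  · have := IsMinParam.comp_neg h
    simpa only [ProjectsTo, ζ.reverse_apply, neg_neg] using this
  · have := IsMinParam.comp_neg h
    rwa [neg_neg] at this

theorem projectsTo_reverse_right {ζ ζ' : GeodLine X} {e s : EReal} :
    ProjectsTo ζ ζ'.reverse e s ↔ ProjectsTo ζ ζ' (-e) s := by
  unfold ProjectsTo
  simp only [distOrBusemann_reverse]

/-! ### The ends of the fellow interval -/

theorem isClosed_fellowSet (B : ℝ) (ζ ζ' : GeodLine X) : IsClosed (fellowSet B ζ ζ') :=
  isClosed_le ((Metric.continuous_infDist_pt _).comp ζ.2.continuous) continuous_const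

/-- Separates a finite, attained right end from an infinite one, where the projection is read off
from a Busemann function. -/
theorem sSup_coe_image_cases {S : Set ℝ} (hc : IsClosed S) (hne : S.Nonempty) :
    (∃ b : ℝ, sSup ((fun t : ℝ => (t : EReal)) '' S) = b ∧ IsGreatest S b) ∨
      (sSup ((fun t : ℝ => (t : EReal)) '' S) = ⊤ ∧ ∀ q, ∃ u ∈ S, q < u) := by
  obtain ⟨x, hx⟩ := hne
  have hlub := isLUB_sSup ((fun t : ℝ => (t : EReal)) '' S)
  generalize sSup ((fun t : ℝ => (t : EReal)) '' S) = e at hlub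
  induction e with
  | bot => exact absurd (hlub.1 ⟨x, hx, rfl⟩) (by simp)
  | top =>
    refine Or.inr ⟨rfl, fun q => ?_⟩
    by_contra! hcon
    have : (⊤ : EReal) ≤ q := hlub.2 (by
      rintro _ ⟨u, hu, rfl⟩
      exact EReal.coe_le_coe_iff.2 (hcon u hu))
    exact absurd this (by simp)
  | coe b =>
    refine Or.inl ⟨b, rfl, ?_⟩
    have hb : IsLUB S b := by
      refine ⟨fun u hu => EReal.coe_le_coe_iff.1 (hlub.1 ⟨u, hu, rfl⟩), fun c hc => ?_⟩
      refine EReal.coe_le_coe_iff.1 (hlub.2 ?_)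
      rintro _ ⟨u, hu, rfl⟩
      exact EReal.coe_le_coe_iff.2 (hc hu)
    exact ⟨hb.mem_of_isClosed ⟨x, hx⟩ hc, hb.1⟩

/-! ### Orientation of fellow travelling lines -/

section Coarse

variable {h : ℝ → ℝ} {I : Set ℝ} {K : ℝ}

/-- Turning back below `h q₀` after `q₁` would require a descent from `h q₁` of more than `b - q₁`,
against the Lipschitz bound. -/
theorem coarse_increasing_right (hl : ∀ u v, |h u - h v| ≤ |u - v|)
    (hI : ∀ u ∈ I, ∀ v ∈ I, |u - v| - 2 * K ≤ |h u - h v|) {q₀ q₁ b : ℝ} (h₀ : q₀ ∈ I)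
    (h₁ : q₁ ∈ I) (hb : b ∈ I) (hq : 2 * K < q₁ - q₀) (hK : 0 ≤ K) (hlt : h q₀ < h q₁)
    (hqb : q₁ ≤ b) : b - q₀ - 2 * K ≤ h b - h q₀ := by
  have h1 := hI q₁ h₁ q₀ h₀
  have h2 := hI b hb q₀ h₀
  rw [abs_of_pos (by linarith), abs_of_pos (by linarith)] at h1
  rw [abs_of_pos (by linarith)] at h2
  have h3 := (le_abs_self _).trans (hl q₁ b)
  rw [abs_sub_comm, abs_of_nonneg (by linarith)] at h3
  rcases le_or_gt 0 (h b - h q₀) with hs | hs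
  · rwa [abs_of_nonneg hs] at h2
  · rw [abs_of_neg hs] at h2
    linarith

end Coarse

section CAT0

variable [IsCAT0 X]

theorem GeodLine.projParam_reverse (γ : GeodLine X) (p : X) :
    γ.reverse.projParam p = -γ.projParam p :=
  γ.reverse.projParam_eq fun u => by
    rw [γ.reverse_apply, neg_neg]
    exact γ.dist_projParam_le p (-u)

theorem ordConnected_fellowSet (B : ℝ) (ζ ζ' : GeodLine X) : (fellowSet B ζ ζ').OrdConnected := by
  have := ((ζ.geodOn univ).convexOn_infDist convex_univ ζ').convex_le (6 * B + 2)
  simp only [mem_univ, true_and] at this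
  exact this.ordConnected

/-- A minimum is attained, which excludes the ends `±∞`, and the minimizer is unique. -/
theorem projectsTo_coe_iff {ζ ζ' : GeodLine X} {e : ℝ} {s : EReal} :
    ProjectsTo ζ ζ' e s ↔ s = (ζ.projParam (ζ'.1 e) : ℝ) := by
  have hf : (fun t => distOrBusemann ζ' e (ζ.1 t)) = fun t => dist (ζ'.1 e) (ζ.1 t) := by
    funext t
    rw [distOrBusemann, if_neg (EReal.coe_ne_top e), if_neg (EReal.coe_ne_bot e), EReal.toReal_coe]
  rw [ProjectsTo, hf]
  constructor
  · rintro (⟨t, rfl, ht⟩ | ⟨-, ht⟩ | ⟨-, ht⟩)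
    · rw [ζ.projParam_eq ht]
    · obtain ⟨u, hu⟩ := (ht (ζ.projParam (ζ'.1 e))).exists
      exact absurd (ζ.dist_projParam_le _ u) (not_le.2 hu)
    · obtain ⟨u, hu⟩ := (ht (ζ.projParam (ζ'.1 e))).exists
      exact absurd (ζ.dist_projParam_le _ u) (not_le.2 hu)
  · rintro rfl
    exact Or.inl ⟨_, rfl, fun u => ζ.dist_projParam_le _ u⟩

end CAT0

/-- By the triangle inequality the function of `u` is antitone and bounded below, so the `limUnder`
in `distOrBusemann` is a genuine limit. -/
theorem tendsto_distOrBusemann_top (ζ : GeodLine X) (z : X) :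
    Tendsto (fun u => dist (ζ.1 u) z - u) atTop (𝓝 (distOrBusemann ζ ⊤ z)) := by
  have hanti : Antitone fun u => dist (ζ.1 u) z - u := fun u v huv => by
    have := dist_triangle (ζ.1 v) (ζ.1 u) z
    rw [ζ.dist_eq, abs_of_nonneg (sub_nonneg.2 huv)] at this
    change _ - _ ≤ _ - _
    linarith
  have hbdd : BddBelow (range fun u => dist (ζ.1 u) z - u) := by
    refine ⟨-dist z (ζ.1 0), ?_⟩
    rintro _ ⟨u, rfl⟩
    have := dist_triangle (ζ.1 u) z (ζ.1 0)
    rw [ζ.dist_eq, sub_zero] at this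
    change _ ≤ _ - _
    linarith [le_abs_self u]
  have hlim := tendsto_atTop_ciInf hanti hbdd
  have hlim' : Tendsto (fun u => dist (ζ.1 u) z - dist (ζ.1 u) (ζ.1 0)) atTop
      (𝓝 (⨅ u, dist (ζ.1 u) z - u)) := by
    refine hlim.congr' ?_
    filter_upwards [eventually_ge_atTop 0] with u hu
    rw [ζ.dist_eq, sub_zero, abs_of_nonneg hu]
  rw [distOrBusemann, if_pos rfl, hlim'.limUnder_eq]
  exact hlim

/-- If the positive ray of `ζ` stays close to the positive ray of `ζ'`, then the point `ζ(∞)`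
projects to the positive end of `ζ'`. -/
theorem projectsTo_top_iff {ζ ζ' : GeodLine X} {K : ℝ}
    (hK : ∀ᶠ u in atTop, Metric.infDist (ζ.1 u) (range ζ'.1) ≤ K)
    (hlim : Tendsto (fun u => ζ'.projParam (ζ.1 u)) atTop atTop) {s : EReal} :
    ProjectsTo ζ' ζ ⊤ s ↔ s = ⊤ := by
  -- The Busemann function descends along `ζ'` at unit speed up to `2K`: paths from `ζ u` to `ζ' t`
  -- and `ζ' t'` pass, up to `K`, through the projection of `ζ u`.
  have key : ∀ t t', t ≤ t' → distOrBusemann ζ ⊤ (ζ'.1 t') ≤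
      distOrBusemann ζ ⊤ (ζ'.1 t) + (2 * K - (t' - t)) := by
    intro t t' htt'
    refine le_of_tendsto_of_tendsto (tendsto_distOrBusemann_top ζ (ζ'.1 t'))
      ((tendsto_distOrBusemann_top ζ (ζ'.1 t)).add_const _) ?_
    filter_upwards [hK, hlim.eventually_ge_atTop t'] with u hu hu'
    rw [ζ'.infDist_eq] at hu
    have h1 := dist_triangle (ζ.1 u) (ζ'.1 (ζ'.projParam (ζ.1 u))) (ζ'.1 t')
    have h2 := dist_triangle_left (ζ'.1 (ζ'.projParam (ζ.1 u))) (ζ'.1 t) (ζ.1 u)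
    rw [ζ'.dist_eq, abs_of_nonneg (by linarith)] at h1 h2
    linarith
  have htop : ∀ t, ∀ᶠ u in atTop, distOrBusemann ζ ⊤ (ζ'.1 u) < distOrBusemann ζ ⊤ (ζ'.1 t) := by
    intro t
    filter_upwards [eventually_gt_atTop (t + 2 * |K|)] with u hu
    have := key t u (by linarith [abs_nonneg K])
    linarith [le_abs_self K]
  constructor
  · rintro (⟨t, rfl, ht⟩ | ⟨rfl, -⟩ | ⟨-, ht⟩)
    · obtain ⟨u, hu⟩ := (htop t).exists
      exact absurd (ht u) (not_le.2 hu)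
    · rfl
    · obtain ⟨u, hu, hu'⟩ := ((ht 0).and (eventually_lt_atBot (-2 * |K|))).exists
      have := key u 0 (by linarith [abs_nonneg K])
      linarith [le_abs_self K]
  · rintro rfl
    exact Or.inr (Or.inl ⟨rfl, htop⟩)

theorem abs_sub_le_of_mem_fellowSet {B : ℝ} {ζ ζ' : GeodLine X} {u v : ℝ}
    (hu : u ∈ fellowSet B ζ ζ') (hv : v ∈ fellowSet B ζ ζ') :
    |u - v| - 2 * (6 * B + 2) ≤ |ζ'.projParam (ζ.1 u) - ζ'.projParam (ζ.1 v)| := by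
  have := ζ'.dist_le_abs_projParam_sub (ζ.1 u) (ζ.1 v)
  rw [ζ.dist_eq] at this
  have h1 : Metric.infDist (ζ.1 u) (range ζ'.1) ≤ 6 * B + 2 := hu
  have h2 : Metric.infDist (ζ.1 v) (range ζ'.1) ≤ 6 * B + 2 := hv
  linarith

variable [IsCAT0 X]

theorem GeodLine.abs_projParam_apply_sub_le (ζ ζ' : GeodLine X) (u v : ℝ) :
    |ζ'.projParam (ζ.1 u) - ζ'.projParam (ζ.1 v)| ≤ |u - v| :=
  (ζ'.abs_projParam_sub_le _ _).trans_eq (ζ.dist_eq u v)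

/-- The projection of the right end of the fellow interval, if the projection is coarsely
increasing. -/
theorem exists_projectsTo_fellowRight {B : ℝ} (hB : 0 < B) {ζ ζ' : GeodLine X} {q₀ q₁ : ℝ}
    (h₀ : q₀ ∈ fellowSet B ζ ζ') (h₁ : q₁ ∈ fellowSet B ζ ζ') (hq : 2 * (6 * B + 2) < q₁ - q₀)
    (hlt : ζ'.projParam (ζ.1 q₀) < ζ'.projParam (ζ.1 q₁)) :
    ∃ t₀ : EReal, (∀ t, ProjectsTo ζ' ζ (fellowRight B ζ ζ') t ↔ t = t₀) ∧
      ((ζ'.projParam (ζ.1 q₁) - 2 * (6 * B + 2) : ℝ) : EReal) ≤ t₀ := by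
  have hinc : ∀ b ∈ fellowSet B ζ ζ', q₁ ≤ b →
      b - q₀ - 2 * (6 * B + 2) ≤ ζ'.projParam (ζ.1 b) - ζ'.projParam (ζ.1 q₀) :=
    fun b hb hqb => coarse_increasing_right (h := fun u => ζ'.projParam (ζ.1 u))
      (ζ.abs_projParam_apply_sub_le ζ') (fun u hu v hv => abs_sub_le_of_mem_fellowSet hu hv)
      h₀ h₁ hb hq (by linarith) hlt hqb
  rcases sSup_coe_image_cases (isClosed_fellowSet B ζ ζ') ⟨q₀, h₀⟩ with ⟨b, hb, hg⟩ | ⟨hT, hI⟩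
  · refine ⟨(ζ'.projParam (ζ.1 b) : ℝ), fun t => ?_, ?_⟩
    · rw [fellowRight, hb, projectsTo_coe_iff]
    · rw [EReal.coe_le_coe_iff]
      have hqb := hg.2 h₁
      have h1 := hinc b hg.1 hqb
      have h2 := (le_abs_self _).trans (ζ.abs_projParam_apply_sub_le ζ' q₁ q₀)
      rw [abs_of_pos (by linarith)] at h2
      linarith
  -- An infinite right end: the whole ray from `q₁` is close to `ζ'` and its projection escapes to
  -- `∞`, so the end projects to `⊤`.
  · have hmem : ∀ q, q₁ ≤ q → q ∈ fellowSet B ζ ζ' := fun q hq' => by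
      obtain ⟨u, hu, hqu⟩ := hI q
      exact (ordConnected_fellowSet B ζ ζ').out h₁ hu ⟨hq', hqu.le⟩
    refine ⟨⊤, fun t => ?_, le_top⟩
    rw [fellowRight, hT]
    refine projectsTo_top_iff (K := 6 * B + 2) ?_ ?_
    · filter_upwards [eventually_ge_atTop q₁] with u hu using hmem u hu
    · refine tendsto_atTop_mono' atTop (f₁ := fun b => b + (ζ'.projParam (ζ.1 q₀) - q₀ -
        2 * (6 * B + 2))) ?_ (tendsto_atTop_add_const_right _ _ tendsto_id)
      filter_upwards [eventually_ge_atTop q₁] with u hu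
      linarith [hinc u (hmem u hu) hu]

theorem exists_projectsTo_fellowRight' {B : ℝ} (hB : 0 < B) {ζ ζ' : GeodLine X} {q₀ q₁ : ℝ}
    (h₀ : q₀ ∈ fellowSet B ζ ζ') (h₁ : q₁ ∈ fellowSet B ζ ζ') (hq : 2 * (6 * B + 2) < q₁ - q₀)
    (hlt : ζ'.projParam (ζ.1 q₁) < ζ'.projParam (ζ.1 q₀)) :
    ∃ t₀ : EReal, (∀ t, ProjectsTo ζ' ζ (fellowRight B ζ ζ') t ↔ t = t₀) ∧
      t₀ ≤ ((ζ'.projParam (ζ.1 q₁) + 2 * (6 * B + 2) : ℝ) : EReal) := by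
  rw [← fellowSet_reverse_right] at h₀ h₁
  obtain ⟨t₀, h1, h2⟩ := exists_projectsTo_fellowRight hB h₀ h₁ hq (by
    rw [ζ'.projParam_reverse, ζ'.projParam_reverse]; linarith)
  refine ⟨-t₀, fun t => ?_, ?_⟩
  · have := h1 (-t)
    rwa [fellowRight_reverse_right, projectsTo_reverse_left, neg_neg, neg_eq_iff_eq_neg] at this
  · rw [ζ'.projParam_reverse] at h2
    rw [EReal.neg_le, ← EReal.coe_neg]
    convert h2 using 2
    ring

theorem exists_projectsTo_fellowLeft {B : ℝ} (hB : 0 < B) {ζ ζ' : GeodLine X} {q₀ q₁ : ℝ}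
    (h₀ : q₀ ∈ fellowSet B ζ ζ') (h₁ : q₁ ∈ fellowSet B ζ ζ') (hq : 2 * (6 * B + 2) < q₁ - q₀)
    (hlt : ζ'.projParam (ζ.1 q₀) < ζ'.projParam (ζ.1 q₁)) :
    ∃ t₀ : EReal, (∀ t, ProjectsTo ζ' ζ (fellowLeft B ζ ζ') t ↔ t = t₀) ∧
      t₀ ≤ ((ζ'.projParam (ζ.1 q₀) + 2 * (6 * B + 2) : ℝ) : EReal) := by
  have h₀' : -q₀ ∈ fellowSet B ζ.reverse ζ' := by rwa [fellowSet_reverse_left, mem_preimage, neg_neg]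
  have h₁' : -q₁ ∈ fellowSet B ζ.reverse ζ' := by rwa [fellowSet_reverse_left, mem_preimage, neg_neg]
  obtain ⟨t₀, h1, h2⟩ := exists_projectsTo_fellowRight' hB h₁' h₀' (by linarith) (by
    rwa [ζ.reverse_apply, ζ.reverse_apply, neg_neg, neg_neg])
  refine ⟨t₀, fun t => ?_, ?_⟩
  · have := h1 t
    rwa [fellowRight_reverse_left, projectsTo_reverse_right, neg_neg] at this
  · rwa [ζ.reverse_apply, neg_neg] at h2

theorem exists_projectsTo_fellowLeft' {B : ℝ} (hB : 0 < B) {ζ ζ' : GeodLine X} {q₀ q₁ : ℝ}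
    (h₀ : q₀ ∈ fellowSet B ζ ζ') (h₁ : q₁ ∈ fellowSet B ζ ζ') (hq : 2 * (6 * B + 2) < q₁ - q₀)
    (hlt : ζ'.projParam (ζ.1 q₁) < ζ'.projParam (ζ.1 q₀)) :
    ∃ t₀ : EReal, (∀ t, ProjectsTo ζ' ζ (fellowLeft B ζ ζ') t ↔ t = t₀) ∧
      ((ζ'.projParam (ζ.1 q₀) - 2 * (6 * B + 2) : ℝ) : EReal) ≤ t₀ := by
  have h₀' : -q₀ ∈ fellowSet B ζ.reverse ζ' := by rwa [fellowSet_reverse_left, mem_preimage, neg_neg]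
  have h₁' : -q₁ ∈ fellowSet B ζ.reverse ζ' := by rwa [fellowSet_reverse_left, mem_preimage, neg_neg]
  obtain ⟨t₀, h1, h2⟩ := exists_projectsTo_fellowRight hB h₁' h₀' (by linarith) (by
    rwa [ζ.reverse_apply, ζ.reverse_apply, neg_neg, neg_neg])
  refine ⟨t₀, fun t => ?_, ?_⟩
  · have := h1 t
    rwa [fellowRight_reverse_left, projectsTo_reverse_right, neg_neg] at this
  · rwa [ζ.reverse_apply, neg_neg] at h2

/-- If the fellow interval is long, coherent orientation means that the projection is coarsely
increasing. -/
theorem coherentlyOriented_iff {B : ℝ} (hB : 0 < B) {ζ ζ' : GeodLine X} {q₀ q₁ : ℝ}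
    (h₀ : q₀ ∈ fellowSet B ζ ζ') (h₁ : q₁ ∈ fellowSet B ζ ζ') (hq : 6 * (6 * B + 2) < q₁ - q₀) :
    CoherentlyOriented B ζ' ζ ↔ ζ'.projParam (ζ.1 q₀) < ζ'.projParam (ζ.1 q₁) := by
  have habs := abs_sub_le_of_mem_fellowSet h₁ h₀
  rw [abs_of_pos (a := q₁ - q₀) (by linarith)] at habs
  have hq' : 2 * (6 * B + 2) < q₁ - q₀ := by linarith
  constructor
  · rintro ⟨s, t, hs, ht, hst⟩
    -- Otherwise the projection drops by more than `4 (6B + 2)` from `q₀` to `q₁`. Passing to each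
    -- end of the interval costs at most `2 (6B + 2)`, so `t < s`.
    by_contra! hle
    rw [abs_of_nonpos (by linarith)] at habs
    have hlt : ζ'.projParam (ζ.1 q₁) < ζ'.projParam (ζ.1 q₀) := by linarith
    obtain ⟨t₀, h1, h2⟩ := exists_projectsTo_fellowRight' hB h₀ h₁ hq' hlt
    obtain ⟨s₀, h3, h4⟩ := exists_projectsTo_fellowLeft' hB h₀ h₁ hq' hlt
    rw [h1] at ht
    rw [h3] at hs
    subst hs ht
    have := EReal.coe_lt_coe_iff.1 (h4.trans_lt (hst.trans_le h2))
    linarith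
  · intro hlt
    rw [abs_of_pos (by linarith)] at habs
    obtain ⟨t₀, h1, h2⟩ := exists_projectsTo_fellowRight hB h₀ h₁ hq' hlt
    obtain ⟨s₀, h3, h4⟩ := exists_projectsTo_fellowLeft hB h₀ h₁ hq' hlt
    refine ⟨s₀, t₀, (h3 _).2 rfl, (h1 _).2 rfl, h4.trans_lt (lt_of_lt_of_le ?_ h2)⟩
    rw [EReal.coe_lt_coe_iff]
    linarith

end

section

variable {X : Type u} [MetricSpace X]

/-! ### A characterization of `τ_B` for lines -/

/-- Inequalities between values of `τ_B` are checked on positive thresholds, where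
`ofReal_le_tauLine_iff` removes infinite ends and the case distinction. -/
theorem ENNReal.le_of_forall_ofReal_le {a b : ℝ≥0∞}
    (h : ∀ T : ℝ, 0 < T → ENNReal.ofReal T ≤ a → ENNReal.ofReal T ≤ b) : a ≤ b := by
  refine ENNReal.le_of_forall_nnreal_lt fun r hr => ?_
  rcases eq_zero_or_pos r with rfl | hr0
  · simp
  · have := h r hr0
    rw [ENNReal.ofReal_coe_nnreal] at this
    exact this hr.le

theorem distToParam_reverse (ζ : GeodLine X) (p : X) (e : EReal) :
    distToParam ζ.reverse p e = distToParam ζ p (-e) := by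
  unfold distToParam
  induction e with
  | top => simp
  | bot => simp
  | coe r =>
    have h1 : -(r : EReal) ≠ ⊤ := EReal.coe_ne_top (-r)
    have h2 : -(r : EReal) ≠ ⊥ := EReal.coe_ne_bot (-r)
    rw [if_neg (by simp), if_neg (by simp [h1, h2]), ζ.reverse_apply, EReal.toReal_neg_eq]

theorem CoherentlyOriented.reverse {B : ℝ} {ζ ζ' : GeodLine X} (h : CoherentlyOriented B ζ ζ') :
    CoherentlyOriented B ζ.reverse ζ'.reverse := by
  obtain ⟨s, t, hs, ht, hst⟩ := h
  refine ⟨-t, -s, ?_, ?_, EReal.neg_lt_neg_iff.2 hst⟩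
  · rwa [projectsTo_reverse_left, projectsTo_reverse_right, fellowLeft_reverse_left,
      fellowRight_reverse_right, neg_neg, neg_neg]
  · rwa [projectsTo_reverse_left, projectsTo_reverse_right, fellowRight_reverse_left,
      fellowLeft_reverse_right, neg_neg, neg_neg]

section CAT0

variable [IsCAT0 X]

theorem ofReal_le_distToParam_fellowRight_iff {B : ℝ} {ζ ζ' : GeodLine X} {p T : ℝ} (hT : 0 ≤ T)
    (hp : p ∈ fellowSet B ζ ζ') :
    ENNReal.ofReal T ≤ distToParam ζ (ζ.1 p) (fellowRight B ζ ζ') ↔ p + T ∈ fellowSet B ζ ζ' := by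
  have hord := ordConnected_fellowSet B ζ ζ'
  rcases sSup_coe_image_cases (isClosed_fellowSet B ζ ζ') ⟨p, hp⟩ with ⟨b, hb, hg⟩ | ⟨hb, hI⟩
  · have hpb := hg.2 hp
    rw [fellowRight, hb, distToParam, if_neg (by simp), EReal.toReal_coe, ζ.dist_eq, abs_sub_comm,
      abs_of_nonneg (by linarith), ENNReal.ofReal_le_ofReal_iff (by linarith)]
    exact ⟨fun h => hord.out hp hg.1 ⟨by linarith, by linarith⟩, fun h => by linarith [hg.2 h]⟩
  · obtain ⟨u, hu, hlt⟩ := hI (p + T)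
    rw [fellowRight, hb, distToParam, if_pos (by simp)]
    exact ⟨fun _ => hord.out hp hu ⟨by linarith, hlt.le⟩, fun _ => le_top⟩

theorem ofReal_le_distToParam_fellowLeft_iff {B : ℝ} {ζ ζ' : GeodLine X} {p T : ℝ} (hT : 0 ≤ T)
    (hp : p ∈ fellowSet B ζ ζ') :
    ENNReal.ofReal T ≤ distToParam ζ (ζ.1 p) (fellowLeft B ζ ζ') ↔ p - T ∈ fellowSet B ζ ζ' := by
  have hp' : -p ∈ fellowSet B ζ.reverse ζ' := by rwa [fellowSet_reverse_left, mem_preimage, neg_neg]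
  have := ofReal_le_distToParam_fellowRight_iff hT hp'
  rwa [distToParam_reverse, fellowRight_reverse_left, neg_neg, ζ.reverse_apply, neg_neg,
    fellowSet_reverse_left, mem_preimage, neg_add_rev, neg_neg, neg_add_eq_sub] at this

/-- Since the fellow sets are closed and order connected, distance at least `T` to both ends means
that the two parameters at distance `T` still belong to the set. Positivity of `T` excludes the
default value `0`. -/
theorem ofReal_le_tauLine_iff {B : ℝ} {x : X} {ζ₁ ζ₂ : GeodLine X} {T : ℝ} (hT : 0 < T) :
    ENNReal.ofReal T ≤ tauLine B x ζ₁ ζ₂ ↔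
      (CoherentlyOriented B ζ₁ ζ₂ ∧ CoherentlyOriented B ζ₂ ζ₁) ∧
      (ζ₁.projParam x - T ∈ fellowSet B ζ₁ ζ₂ ∧ ζ₁.projParam x + T ∈ fellowSet B ζ₁ ζ₂) ∧
      (ζ₂.projParam x - T ∈ fellowSet B ζ₂ ζ₁ ∧ ζ₂.projParam x + T ∈ fellowSet B ζ₂ ζ₁) := by
  rw [tauLine]
  split_ifs with h
  · obtain ⟨-, -, h1, h2, h3, h4⟩ := h
    rw [endDist, endDist, le_min_iff, le_min_iff, le_min_iff,
      ofReal_le_distToParam_fellowRight_iff hT.le h3, ofReal_le_distToParam_fellowRight_iff hT.le h4,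
      ofReal_le_distToParam_fellowLeft_iff hT.le h3, ofReal_le_distToParam_fellowLeft_iff hT.le h4]
    exact ⟨fun h => ⟨⟨h1, h2⟩, h⟩, fun h => h.2⟩
  · constructor
    · intro h0
      exact absurd (ENNReal.ofReal_pos.2 hT) (not_lt.2 h0)
    · rintro ⟨⟨h1, h2⟩, ⟨h3, h4⟩, h5, h6⟩
      refine absurd ⟨⟨_, h3⟩, ⟨_, h5⟩, h1, h2, ?_, ?_⟩ h
      · exact (ordConnected_fellowSet B ζ₁ ζ₂).out h3 h4 ⟨by linarith, by linarith⟩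
      · exact (ordConnected_fellowSet B ζ₂ ζ₁).out h5 h6 ⟨by linarith, by linarith⟩

theorem tauLine_comm (B : ℝ) (x : X) (ζ₁ ζ₂ : GeodLine X) :
    tauLine B x ζ₁ ζ₂ = tauLine B x ζ₂ ζ₁ := by
  have : ∀ ζ₁ ζ₂ : GeodLine X, tauLine B x ζ₁ ζ₂ ≤ tauLine B x ζ₂ ζ₁ := fun ζ₁ ζ₂ =>
    ENNReal.le_of_forall_ofReal_le fun T hT h => by
      rw [ofReal_le_tauLine_iff hT] at h ⊢
      exact ⟨h.1.symm, h.2.symm⟩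
  exact le_antisymm (this _ _) (this _ _)

theorem tauLine_le_tauLine_reverse (B : ℝ) (x : X) (ζ₁ ζ₂ : GeodLine X) :
    tauLine B x ζ₁ ζ₂ ≤ tauLine B x ζ₁.reverse ζ₂.reverse := by
  refine ENNReal.le_of_forall_ofReal_le fun T hT h => ?_
  rw [ofReal_le_tauLine_iff hT] at h ⊢
  obtain ⟨⟨h1, h2⟩, ⟨h3, h4⟩, h5, h6⟩ := h
  simp only [fellowSet_reverse_left, fellowSet_reverse_right, GeodLine.projParam_reverse,
    mem_preimage, neg_sub, sub_neg_eq_add, neg_add_eq_sub]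
  rw [add_comm T, add_comm T]
  exact ⟨⟨h1.reverse, h2.reverse⟩, ⟨h4, h3⟩, h6, h5⟩

/-- The fellow sets and orientations do not depend on the base point, and each projection moves by
at most `dist x y`. -/
theorem tauLine_le_add_dist (B : ℝ) (x y : X) (ζ₁ ζ₂ : GeodLine X) :
    tauLine B x ζ₁ ζ₂ ≤ tauLine B y ζ₁ ζ₂ + ENNReal.ofReal (dist x y) := by
  refine ENNReal.le_of_forall_ofReal_le fun T hT h => ?_
  rcases le_or_gt T (dist x y) with hle | hlt
  · exact le_add_left (ENNReal.ofReal_le_ofReal hle)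
  rw [← tsub_le_iff_right, ← ENNReal.ofReal_sub _ dist_nonneg]
  rw [ofReal_le_tauLine_iff hT] at h
  rw [ofReal_le_tauLine_iff (by linarith)]
  obtain ⟨h0, ⟨h3, h4⟩, h5, h6⟩ := h
  have e1 := abs_le.1 (ζ₁.abs_projParam_sub_le x y)
  have e2 := abs_le.1 (ζ₂.abs_projParam_sub_le x y)
  have o1 := (ordConnected_fellowSet B ζ₁ ζ₂).out h3 h4
  have o2 := (ordConnected_fellowSet B ζ₂ ζ₁).out h5 h6
  exact ⟨h0, ⟨o1 ⟨by linarith, by linarith⟩, o1 ⟨by linarith, by linarith⟩⟩,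
    o2 ⟨by linarith, by linarith⟩, o2 ⟨by linarith, by linarith⟩⟩

theorem tau_comm (B : ℝ) (x : X) (α β : VisualBoundary X × VisualBoundary X) :
    tau B x α β = tau B x β α := by
  have : ∀ α β : VisualBoundary X × VisualBoundary X, tau B x α β ≤ tau B x β α := fun α β => by
    refine le_iInf₂ fun ζ₁ h₁ => le_iInf₂ fun ζ₂ h₂ => ?_
    rw [tauLine_comm]
    exact iInf₂_le_of_le ζ₂ h₂ (iInf₂_le ζ₁ h₁)
  exact le_antisymm (this _ _) (this _ _)

theorem tau_le_tau_swap (B : ℝ) (x : X) (α β : VisualBoundary X × VisualBoundary X) :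
    tau B x α β ≤ tau B x α.swap β.swap := by
  refine le_iInf₂ fun ζ₁ h₁ => le_iInf₂ fun ζ₂ h₂ => ?_
  refine (iInf₂_le_of_le ζ₁.reverse h₁.reverse (iInf₂_le ζ₂.reverse h₂.reverse)).trans ?_
  have := tauLine_le_tauLine_reverse B x ζ₁.reverse ζ₂.reverse
  rwa [ζ₁.reverse_reverse, ζ₂.reverse_reverse] at this

theorem tau_swap (B : ℝ) (x : X) (α β : VisualBoundary X × VisualBoundary X) :
    tau B x α.swap β.swap = tau B x α β :=
  le_antisymm (tau_le_tau_swap B x α.swap β.swap) (tau_le_tau_swap B x α β)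

theorem tau_le_add_dist (B : ℝ) (x y : X) (α β : VisualBoundary X × VisualBoundary X) :
    tau B x α β ≤ tau B y α β + ENNReal.ofReal (dist x y) := by
  rw [← tsub_le_iff_right]
  refine le_iInf₂ fun ζ₁ h₁ => le_iInf₂ fun ζ₂ h₂ => ?_
  rw [tsub_le_iff_right]
  exact (iInf₂_le_of_le ζ₁ h₁ (iInf₂_le ζ₂ h₂)).trans (tauLine_le_add_dist B x y ζ₁ ζ₂)

end CAT0

/-! ### Isometries -/

theorem GeodLine.range_map (g : X ≃ᵢ X) (γ : GeodLine X) : range (γ.map g).1 = g '' range γ.1 :=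
  range_comp g γ.1

theorem fellowSet_map (g : X ≃ᵢ X) (B : ℝ) (ζ ζ' : GeodLine X) :
    fellowSet B (ζ.map g) (ζ'.map g) = fellowSet B ζ ζ' := by
  ext t
  simp only [fellowSet, mem_ofPred_eq, GeodLine.range_map]
  rw [show (ζ.map g).1 t = g (ζ.1 t) from rfl, Metric.infDist_image g.isometry]

theorem distOrBusemann_map (g : X ≃ᵢ X) (ζ : GeodLine X) (e : EReal) (z : X) :
    distOrBusemann (ζ.map g) e (g z) = distOrBusemann ζ e z := by
  have : ∀ (u : ℝ) (y : X), dist ((ζ.map g).1 u) (g y) = dist (ζ.1 u) y := fun u y => g.dist_eq _ _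
  unfold distOrBusemann
  rw [show (ζ.map g).1 0 = g (ζ.1 0) from rfl]
  simp only [this]

theorem coherentlyOriented_map (g : X ≃ᵢ X) (B : ℝ) (ζ ζ' : GeodLine X) :
    CoherentlyOriented B (ζ.map g) (ζ'.map g) ↔ CoherentlyOriented B ζ ζ' := by
  have h : ∀ e s, ProjectsTo (ζ.map g) (ζ'.map g) e s ↔ ProjectsTo ζ ζ' e s := fun e s => by
    unfold ProjectsTo
    have : (fun t => distOrBusemann (ζ'.map g) e ((ζ.map g).1 t)) =
        fun t => distOrBusemann ζ' e (ζ.1 t) :=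
      funext fun t => distOrBusemann_map g ζ' e (ζ.1 t)
    rw [this]
  unfold CoherentlyOriented fellowLeft fellowRight
  simp only [h, fellowSet_map]

section CAT0

variable [IsCAT0 X]

theorem GeodLine.projParam_map (g : X ≃ᵢ X) (γ : GeodLine X) (p : X) :
    (γ.map g).projParam (g p) = γ.projParam p :=
  (γ.map g).projParam_eq fun u => by
    change dist (g p) (g _) ≤ dist (g p) (g _)
    rw [g.dist_eq, g.dist_eq]
    exact γ.dist_projParam_le p u

theorem tauLine_map (g : X ≃ᵢ X) (B : ℝ) (x : X) (ζ₁ ζ₂ : GeodLine X) :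
    tauLine B (g x) (ζ₁.map g) (ζ₂.map g) = tauLine B x ζ₁ ζ₂ := by
  refine le_antisymm ?_ ?_ <;> refine ENNReal.le_of_forall_ofReal_le fun T hT h => ?_ <;>
  · rw [ofReal_le_tauLine_iff hT] at h ⊢
    simpa only [coherentlyOriented_map, fellowSet_map, GeodLine.projParam_map] using h

end CAT0

theorem VisualBoundary.map_symm_map (g : X ≃ᵢ X) (ξ : VisualBoundary X) :
    VisualBoundary.map g.symm (VisualBoundary.map g ξ) = ξ := by
  induction ξ using Quotient.inductionOn with
  | h r =>
    change GeodRay.endpoint _ = GeodRay.endpoint _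
    congr 1
    refine Subtype.ext (ContinuousMap.ext fun t => ?_)
    exact g.symm_apply_apply _

theorem ContractingPairs.map_symm_map {B : ℝ} (g : X ≃ᵢ X) (α : ContractingPairs X B) :
    ContractingPairs.map g.symm (ContractingPairs.map g α) = α :=
  Subtype.ext (Prod.ext (VisualBoundary.map_symm_map g _) (VisualBoundary.map_symm_map g _))

theorem ContractingPairs.flip_flip {B : ℝ} (α : ContractingPairs X B) :
    ContractingPairs.flip (ContractingPairs.flip α) = α :=
  Subtype.ext (Prod.swap_swap _)

variable [IsCAT0 X]

theorem tau_map_le {B : ℝ} (g : X ≃ᵢ X) (x : X) (α β : ContractingPairs X B) :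
    tau B (g x) (ContractingPairs.map g α).1 (ContractingPairs.map g β).1 ≤ tau B x α.1 β.1 := by
  refine le_iInf₂ fun ζ₁ h₁ => le_iInf₂ fun ζ₂ h₂ => ?_
  rw [← tauLine_map g]
  exact iInf₂_le_of_le (ζ₁.map g) (h₁.map g) (iInf₂_le (ζ₂.map g) (h₂.map g))

theorem tau_map {B : ℝ} (g : X ≃ᵢ X) (x : X) (α β : ContractingPairs X B) :
    tau B (g x) (ContractingPairs.map g α).1 (ContractingPairs.map g β).1 = tau B x α.1 β.1 := by
  refine le_antisymm (tau_map_le g x α β) ?_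
  have := tau_map_le g.symm (g x) (ContractingPairs.map g α)
    (ContractingPairs.map g β)
  rwa [g.symm_apply_apply, ContractingPairs.map_symm_map, ContractingPairs.map_symm_map] at this

end

section

variable {X : Type u} [MetricSpace X]

/-! ### Fellow travelling lines -/

/-- The lines `ζ`, `ζ'` stay within `K` of each other up to time `T` from the projections of `x`. -/
def Fellow (K T : ℝ) (x : X) (ζ ζ' : GeodLine X) : Prop :=
  ∀ t, |t| ≤ T → dist (ζ.1 (ζ.projParam x + t)) (ζ'.1 (ζ'.projParam x + t)) ≤ K

theorem Fellow.symm {K T : ℝ} {x : X} {ζ ζ' : GeodLine X} (h : Fellow K T x ζ ζ') :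
    Fellow K T x ζ' ζ :=
  fun t ht => (dist_comm _ _).trans_le (h t ht)

theorem Fellow.trans {K K' T : ℝ} {x : X} {ζ ζ' ζ'' : GeodLine X} (h : Fellow K T x ζ ζ')
    (h' : Fellow K' T x ζ' ζ'') : Fellow (K + K') T x ζ ζ'' :=
  fun t ht => (dist_triangle _ _ _).trans (add_le_add (h t ht) (h' t ht))

theorem Fellow.mono {K T T' : ℝ} {x : X} {ζ ζ' : GeodLine X} (h : Fellow K T x ζ ζ')
    (hT : T' ≤ T) : Fellow K T' x ζ ζ' :=
  fun t ht => h t (ht.trans hT)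

theorem exists_between_dist_eq [IsCAT0 X] (a b : X) {r : ℝ} (hr : r ∈ Icc 0 (dist a b)) :
    ∃ y, dist a y = r ∧ dist y b = dist a b - r := by
  obtain ⟨c, h0, h1, hc⟩ := IsCAT0.exists_geodesic a b
  have hd : (0 : ℝ) ≤ dist a b := dist_nonneg
  refine ⟨c r, ?_, ?_⟩
  · nth_rw 1 [← h0]
    rw [hc 0 (left_mem_Icc.2 hd) r hr, zero_sub, abs_neg, abs_of_nonneg hr.1]
  · nth_rw 1 [← h1]
    rw [hc r hr _ (right_mem_Icc.2 hd), abs_sub_comm, abs_of_nonneg (by linarith [hr.2])]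

theorem GeodLine.posEnd_eq_iff {ζ ζ' : GeodLine X} :
    ζ.posEnd = ζ'.posEnd ↔ ∃ K : ℝ, ∀ t : ℝ, 0 ≤ t → dist (ζ.1 t) (ζ'.1 t) ≤ K := by
  constructor
  · intro h
    obtain ⟨K, hK⟩ := Quotient.exact h
    exact ⟨K, fun t ht => hK ⟨t, ht⟩⟩
  · rintro ⟨K, hK⟩
    exact Quotient.sound ⟨K, fun t => hK t t.2⟩

theorem GeodLine.negEnd_eq_iff {ζ ζ' : GeodLine X} :
    ζ.negEnd = ζ'.negEnd ↔ ∃ K : ℝ, ∀ t : ℝ, 0 ≤ t → dist (ζ.1 (-t)) (ζ'.1 (-t)) ≤ K :=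
  GeodLine.posEnd_eq_iff

theorem GeodLine.ends_eq_iff {ζ ζ' : GeodLine X} :
    (ζ.negEnd = ζ'.negEnd ∧ ζ.posEnd = ζ'.posEnd) ↔ ∃ K : ℝ, ∀ t, dist (ζ.1 t) (ζ'.1 t) ≤ K := by
  rw [GeodLine.negEnd_eq_iff, GeodLine.posEnd_eq_iff]
  constructor
  · rintro ⟨⟨K, hK⟩, K', hK'⟩
    refine ⟨max K K', fun t => ?_⟩
    rcases le_total 0 t with ht | ht
    · exact (hK' t ht).trans (le_max_right _ _)
    · have := hK (-t) (by linarith)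
      rw [neg_neg] at this
      exact this.trans (le_max_left _ _)
  · rintro ⟨K, hK⟩
    exact ⟨⟨K, fun t _ => hK _⟩, K, fun t _ => hK _⟩

theorem fellow_of_forall_dist_le {ζ ζ' : GeodLine X} {K : ℝ}
    (hK : ∀ t, dist (ζ.1 t) (ζ'.1 t) ≤ K) (x : X) (T : ℝ) :
    Fellow (K + |ζ.projParam x - ζ'.projParam x|) T x ζ ζ' := fun t _ => by
  refine (dist_triangle _ (ζ'.1 (ζ.projParam x + t)) _).trans (add_le_add (hK _) ?_)
  rw [ζ'.dist_eq, add_sub_add_right_eq_sub]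

theorem forall_dist_le_of_fellow {ζ ζ' : GeodLine X} {K : ℝ} {x : X}
    (h : ∀ T, Fellow K T x ζ ζ') (t : ℝ) :
    dist (ζ.1 t) (ζ'.1 t) ≤ K + |ζ.projParam x - ζ'.projParam x| := by
  have h1 := h _ (t - ζ.projParam x) le_rfl
  refine (dist_triangle _ (ζ'.1 (ζ'.projParam x + (t - ζ.projParam x))) _).trans
    (add_le_add ?_ ?_)
  · rwa [add_sub_cancel] at h1
  · rw [ζ'.dist_eq, abs_sub_comm, show t - (ζ'.projParam x + (t - ζ.projParam x)) =
      ζ.projParam x - ζ'.projParam x by ring]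

variable [IsCAT0 X]

/-- If the projections of `x` to two lines are close to the other line, then they are close to each
other. -/
theorem GeodLine.IsContracting.dist_projParam_projParam_le {B : ℝ} (hB : 0 < B) {ζ ζ' : GeodLine X}
    (h : ζ.IsContracting B) {x : X} (h₁ : ζ.projParam x ∈ fellowSet B ζ ζ')
    (h₂ : ζ'.projParam x ∈ fellowSet B ζ' ζ) :
    dist (ζ.1 (ζ.projParam x)) (ζ'.1 (ζ'.projParam x)) ≤ 13 * B + 5 := by
  have e1 : Metric.infDist (ζ.1 (ζ.projParam x)) (range ζ'.1) ≤ 6 * B + 2 := h₁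
  have e2 : Metric.infDist (ζ'.1 (ζ'.projParam x)) (range ζ.1) ≤ 6 * B + 2 := h₂
  have e3 := infDist_le_infDist_add (range ζ'.1) x (ζ.1 (ζ.projParam x))
  rw [ζ'.infDist_eq x] at e3
  set x₁ := ζ.1 (ζ.projParam x)
  set x₂ := ζ'.1 (ζ'.projParam x)
  rcases lt_or_ge (dist x x₁) 1 with hlt | hge
  · linarith [dist_triangle_left x₁ x₂ x]
  -- The ball about `x` of radius `d(x, x₁) - 1` misses `ζ`, so going inside it towards `x₂` moves
  -- the projection by at most `B`. The remaining way has length at most `6B + 3` because `d(x, x₂)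
  -- ≤ d(x, x₁) + 6B + 2`.
  have hr0 : 0 ≤ min (dist x x₁ - 1) (dist x x₂) := le_min (by linarith) dist_nonneg
  obtain ⟨y, hy1, hy2⟩ := exists_between_dist_eq x x₂ ⟨hr0, min_le_right _ _⟩
  have e4 := h.abs_projParam_sub_le hB.le (p := x) (y := y) (r := dist x x₁ - 1)
    (by rw [ζ.infDist_eq]; linarith) (hy1.trans_le (min_le_left _ _))
  have e5 : dist y x₂ ≤ 6 * B + 3 := by
    rw [hy2]
    rcases min_cases (dist x x₁ - 1) (dist x x₂) with h | h <;> rw [h.1] <;> linarith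
  have e6 := (ζ.abs_projParam_sub_le y x₂).trans e5
  have e7 := dist_triangle x₁ (ζ.1 (ζ.projParam x₂)) x₂
  have e9 : dist x₁ (ζ.1 (ζ.projParam x₂)) = |ζ.projParam x - ζ.projParam x₂| := ζ.dist_eq _ _
  rw [dist_comm (ζ.1 (ζ.projParam x₂)) x₂, ← ζ.infDist_eq, e9] at e7
  have e8 := abs_sub_le (ζ.projParam x) (ζ.projParam y) (ζ.projParam x₂)
  linarith

/-- Lines fellow travel on a long arc if they are close there with the same orientation. -/
theorem dist_le_of_infDist_le {ζ ζ' : GeodLine X} {p p' T K M : ℝ}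
    (hK : ∀ t, |t| ≤ T → Metric.infDist (ζ.1 (p + t)) (range ζ'.1) ≤ K)
    (hinc : 2 * T - 2 * K ≤ ζ'.projParam (ζ.1 (p + T)) - ζ'.projParam (ζ.1 (p - T)))
    (hM : |ζ'.projParam (ζ.1 p) - p'| ≤ M) {t : ℝ} (ht : |t| ≤ T) :
    dist (ζ.1 (p + t)) (ζ'.1 (p' + t)) ≤ 3 * K + M := by
  have hT : 0 ≤ T := (abs_nonneg t).trans ht
  have ht' := abs_le.1 ht
  -- The projection is 1-Lipschitz and falls short of the maximal gain `2T` by at most `2K`; hence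
  -- it never lags by more than `2K`.
  have key : ∀ s, |s| ≤ T →
      ζ'.projParam (ζ.1 (p + s)) ≤ ζ'.projParam (ζ.1 (p - T)) + (T + s) ∧
      ζ'.projParam (ζ.1 (p - T)) + (T + s) - 2 * K ≤ ζ'.projParam (ζ.1 (p + s)) := by
    intro s hs
    have hs' := abs_le.1 hs
    have h1 := (le_abs_self _).trans (ζ.abs_projParam_apply_sub_le ζ' (p + s) (p - T))
    have h2 := (le_abs_self _).trans (ζ.abs_projParam_apply_sub_le ζ' (p + T) (p + s))
    rw [abs_of_nonneg (by linarith)] at h1 h2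
    constructor <;> linarith
  have h1 := key t ht
  have h2 := key 0 (by rwa [abs_zero])
  rw [add_zero, add_zero] at h2
  have h3 : |ζ'.projParam (ζ.1 (p + t)) - (ζ'.projParam (ζ.1 p) + t)| ≤ 2 * K :=
    abs_le.2 ⟨by linarith, by linarith⟩
  have h4 := hK t ht
  rw [ζ'.infDist_eq] at h4
  have h5 := dist_triangle (ζ.1 (p + t)) (ζ'.1 (ζ'.projParam (ζ.1 (p + t)))) (ζ'.1 (p' + t))
  rw [ζ'.dist_eq] at h5
  have h6 := abs_sub_le (ζ'.projParam (ζ.1 (p + t))) (ζ'.projParam (ζ.1 p) + t) (p' + t)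
  rw [add_sub_add_right_eq_sub] at h6
  linarith

/-- The resulting constant does not depend on `T`. The threshold `18B + 6` makes the fellow interval
longer than `6 (6B + 2)`, so coherent orientation forces a coarsely increasing projection. -/
theorem fellow_of_le_tauLine {B : ℝ} (hB : 0 < B) {x : X} {ζ₁ ζ₂ : GeodLine X}
    (h₁ : ζ₁.IsContracting B) {T : ℝ} (hT : 18 * B + 6 < T)
    (h : ENNReal.ofReal T ≤ tauLine B x ζ₁ ζ₂) : Fellow (37 * B + 13) T x ζ₁ ζ₂ := by
  have hT0 : 0 < T := by linarith
  obtain ⟨⟨-, hcoh⟩, ⟨h3, h4⟩, h5, h6⟩ := (ofReal_le_tauLine_iff hT0).1 h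
  have o1 := (ordConnected_fellowSet B ζ₁ ζ₂).out h3 h4
  have o2 := (ordConnected_fellowSet B ζ₂ ζ₁).out h5 h6
  have hp1 : ζ₁.projParam x ∈ fellowSet B ζ₁ ζ₂ := o1 ⟨by linarith, by linarith⟩
  have hp2 : ζ₂.projParam x ∈ fellowSet B ζ₂ ζ₁ := o2 ⟨by linarith, by linarith⟩
  have hd := h₁.dist_projParam_projParam_le hB hp1 hp2
  rw [coherentlyOriented_iff hB h3 h4 (by linarith)] at hcoh
  have habs := abs_sub_le_of_mem_fellowSet h4 h3
  rw [abs_of_pos (sub_pos.2 hcoh), abs_of_pos (by linarith)] at habs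
  have hM : |ζ₂.projParam (ζ₁.1 (ζ₁.projParam x)) - ζ₂.projParam x| ≤ 13 * B + 5 := by
    have := (ζ₂.abs_projParam_sub_le _ _).trans hd
    rwa [ζ₂.projParam_apply] at this
  intro t ht
  have := dist_le_of_infDist_le (K := 6 * B + 2) (fun t ht => o1 ⟨by linarith [(abs_le.1 ht).1],
    by linarith [(abs_le.1 ht).2]⟩) (by linarith) hM ht
  linarith

theorem Fellow.add_mem_fellowSet {B : ℝ} (hB : 0 < B) {x : X} {ζ₁ ζ₂ : GeodLine X} {K T : ℝ}
    (h₂ : ζ₂.IsContracting B) (h : Fellow K T x ζ₁ ζ₂) {t : ℝ}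
    (ht : |t| ≤ T - (3 * K + 2 * B + 1)) (hK : 0 ≤ K) :
    ζ₁.projParam x + t ∈ fellowSet B ζ₁ ζ₂ := by
  have hT : 0 ≤ T := by linarith [abs_nonneg t]
  have ht' := abs_le.1 ht
  refine h₂.infDist_le_of_mem hB (u := ζ₁.projParam x + -T) (v := ζ₁.projParam x + T)
    (ζ₁.geodOn _) ((ζ₂.infDist_le _ _).trans (h (-T) (by rw [abs_neg, abs_of_nonneg hT])))
    ((ζ₂.infDist_le _ _).trans (h T (by rw [abs_of_nonneg hT]))) ⟨?_, ?_⟩ <;> linarith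

theorem Fellow.coherentlyOriented {B : ℝ} (hB : 0 < B) {x : X} {ζ₁ ζ₂ : GeodLine X} {K T : ℝ}
    (h₂ : ζ₂.IsContracting B) (h : Fellow K T x ζ₁ ζ₂) (hK : 0 ≤ K)
    (hT : 4 * K + 20 * B + 7 < T) : CoherentlyOriented B ζ₂ ζ₁ := by
  set S := T - (3 * K + 2 * B + 1) with hS
  have hS0 : 0 < S := by linarith
  have m0 := h.add_mem_fellowSet hB h₂ (t := -S) (by rw [abs_neg, abs_of_pos hS0]) hK
  have m1 := h.add_mem_fellowSet hB h₂ (t := S) (by rw [abs_of_pos hS0]) hK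
  rw [coherentlyOriented_iff hB m0 m1 (by linarith)]
  have e0 := (ζ₂.abs_projParam_sub_le _ _).trans
    (h (-S) (by rw [abs_neg, abs_of_pos hS0]; linarith))
  have e1 := (ζ₂.abs_projParam_sub_le _ _).trans (h S (by rw [abs_of_pos hS0]; linarith))
  rw [ζ₂.projParam_apply] at e0 e1
  linarith [(abs_le.1 e0).2, (abs_le.1 e1).1]

/-- Closeness within `K` improves to `6B + 2` away from end pieces of length `3K + 2B + 1`. The
further loss `K + 18B + 6` leaves an interval long enough to determine the orientation. -/
theorem Fellow.le_tauLine {B : ℝ} (hB : 0 < B) {x : X} {ζ₁ ζ₂ : GeodLine X} {K T : ℝ}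
    (h₁ : ζ₁.IsContracting B) (h₂ : ζ₂.IsContracting B) (h : Fellow K T x ζ₁ ζ₂) (hK : 0 ≤ K) :
    ENNReal.ofReal (T - (4 * K + 20 * B + 7)) ≤ tauLine B x ζ₁ ζ₂ := by
  rcases le_or_gt (T - (4 * K + 20 * B + 7)) 0 with hle | hlt
  · rw [ENNReal.ofReal_of_nonpos hle]
    exact zero_le
  have hT : T - (4 * K + 20 * B + 7) ≤ T - (3 * K + 2 * B + 1) := by linarith
  have hT1 : |T - (4 * K + 20 * B + 7)| ≤ T - (3 * K + 2 * B + 1) := by rwa [abs_of_pos hlt]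
  have hT2 : |-(T - (4 * K + 20 * B + 7))| ≤ T - (3 * K + 2 * B + 1) := by rwa [abs_neg]
  rw [ofReal_le_tauLine_iff hlt]
  refine ⟨⟨h.symm.coherentlyOriented hB h₁ hK (by linarith),
    h.coherentlyOriented hB h₂ hK (by linarith)⟩, ⟨?_, h.add_mem_fellowSet hB h₂ hT1 hK⟩,
    ?_, h.symm.add_mem_fellowSet hB h₁ hT1 hK⟩
  · exact h.add_mem_fellowSet hB h₂ hT2 hK
  · exact h.symm.add_mem_fellowSet hB h₁ hT2 hK

/-- Two contracting lines with the same endpoints fellow travel. -/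
theorem fellow_of_contractingJoins {B : ℝ} (hB : 0 < B) {ζ ζ' : GeodLine X}
    {α : VisualBoundary X × VisualBoundary X} (h : ζ.ContractingJoins B α)
    (h' : ζ'.ContractingJoins B α) (x : X) (T : ℝ) : Fellow (37 * B + 13) T x ζ ζ' := by
  obtain ⟨K, hK⟩ := GeodLine.ends_eq_iff.1 ⟨h.2.1.trans h'.2.1.symm, h.2.2.trans h'.2.2.symm⟩
  have hK0 : 0 ≤ K := dist_nonneg.trans (hK 0)
  -- The uncontrolled `K'` costs only time, which is unlimited here: `τ_B` of the two lines exceeds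
  -- every bound, and this returns the uniform constant.
  set K' := K + |ζ.projParam x - ζ'.projParam x|
  have hf : Fellow (37 * B + 13) (max T (18 * B + 7)) x ζ ζ' := by
    refine fellow_of_le_tauLine hB h.1 ((by linarith : 18 * B + 6 < 18 * B + 7).trans_le
      (le_max_right _ _)) ?_
    have := (fellow_of_forall_dist_le hK x (max T (18 * B + 7) + (4 * K' + 20 * B + 7))).le_tauLine
      hB h.1 h'.1 (by positivity)
    rwa [add_sub_cancel_right] at this
  exact hf.mono (le_max_left _ _)

/-- Replacing both lines by others with the same ends adds `2 (37B + 13)` to `K`, and `4 · 2 (37B +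
13) + 20B + 7 = 316B + 111`. -/
theorem Fellow.le_tau {B : ℝ} (hB : 0 < B) {x : X} {ζ₁ ζ₂ : GeodLine X} {K T : ℝ}
    {α β : VisualBoundary X × VisualBoundary X} (h₁ : ζ₁.ContractingJoins B α)
    (h₂ : ζ₂.ContractingJoins B β) (h : Fellow K T x ζ₁ ζ₂) (hK : 0 ≤ K) :
    ENNReal.ofReal (T - (4 * K + 316 * B + 111)) ≤ tau B x α β := by
  refine le_iInf₂ fun ζ₁' h₁' => le_iInf₂ fun ζ₂' h₂' => ?_
  have := (((fellow_of_contractingJoins hB h₁' h₁ x T).trans h).trans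
    (fellow_of_contractingJoins hB h₂ h₂' x T)).le_tauLine hB h₁'.1 h₂'.1 (by linarith)
  refine le_trans (ENNReal.ofReal_le_ofReal ?_) this
  linarith

theorem fellow_of_le_tau {B : ℝ} (hB : 0 < B) {x : X} {ζ₁ ζ₂ : GeodLine X} {T : ℝ}
    {α β : VisualBoundary X × VisualBoundary X} (h₁ : ζ₁.ContractingJoins B α)
    (h₂ : ζ₂.ContractingJoins B β) (hT : 18 * B + 6 < T) (h : ENNReal.ofReal T ≤ tau B x α β) :
    Fellow (37 * B + 13) T x ζ₁ ζ₂ :=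
  fellow_of_le_tauLine hB h₁.1 hT (h.trans (iInf₂_le_of_le ζ₁ h₁ (iInf₂_le ζ₂ h₂)))

/-- Fellow travelling for all times with one constant forces equal ends. Finiteness makes the
`toReal` in `deltaTilde` harmless. -/
theorem tau_ne_top {B : ℝ} (hB : 0 < B) (x : X) {α β : ContractingPairs X B} (hne : α ≠ β) :
    tau B x α.1 β.1 ≠ ⊤ := by
  intro htop
  obtain ⟨ζ₁, h₁⟩ := α.2
  obtain ⟨ζ₂, h₂⟩ := β.2
  have hf : ∀ T, Fellow (37 * B + 13) T x ζ₁ ζ₂ := fun T =>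
    (fellow_of_le_tau hB h₁ h₂ ((by linarith : 18 * B + 6 < 18 * B + 7).trans_le
      (le_max_right T _)) (by rw [htop]; exact le_top)).mono (le_max_left _ _)
  have := GeodLine.ends_eq_iff.2 ⟨_, forall_dist_le_of_fellow hf⟩
  refine hne (Subtype.ext (Prod.ext ?_ ?_))
  · rw [← h₁.2.1, ← h₂.2.1, this.1]
  · rw [← h₁.2.2, ← h₂.2.2, this.2]

/-- The coarse ultrametric inequality. The middle line joins two fellow travellings into one with
constant `74B + 26`, and `4 (74B + 26) + 316B + 111 ≤ 612 (B + 1)`. -/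
theorem le_tau_of_le_tau {B : ℝ} (hB : 0 < B) {x : X} {α β η : ContractingPairs X B} {T : ℝ}
    (h : ENNReal.ofReal T ≤ tau B x α.1 β.1) (h' : ENNReal.ofReal T ≤ tau B x β.1 η.1) :
    ENNReal.ofReal (T - 612 * (B + 1)) ≤ tau B x α.1 η.1 := by
  rcases le_or_gt T (18 * B + 6) with hle | hlt
  · rw [ENNReal.ofReal_of_nonpos (by linarith)]
    exact zero_le
  obtain ⟨ζ₁, h₁⟩ := α.2
  obtain ⟨ζ₂, h₂⟩ := β.2
  obtain ⟨ζ₃, h₃⟩ := η.2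
  refine le_trans (ENNReal.ofReal_le_ofReal ?_) (((fellow_of_le_tau hB h₁ h₂ hlt h).trans
    (fellow_of_le_tau hB h₂ h₃ hlt h')).le_tau hB h₁ h₃ (by linarith))
  linarith

end

section

variable {X : Type u} [MetricSpace X]

/-! ### Rays and the cone topology -/

/-- A convex function that exceeds its initial value at some time grows at least linearly
afterwards. -/
theorem ConvexOn.le_zero_of_bounded {f : ℝ → ℝ} (hf : ConvexOn ℝ (Ici 0) f) {K : ℝ}
    (hK : ∀ t, 0 ≤ t → f t ≤ K) {t : ℝ} (ht : 0 ≤ t) : f t ≤ f 0 := by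
  by_contra! hlt
  obtain ⟨n, hn⟩ := exists_nat_gt ((K - f 0) / (f t - f 0))
  have hpos : 0 < f t - f 0 := by linarith
  have hn' : K - f 0 < n * (f t - f 0) := (div_lt_iff₀ hpos).1 hn
  have hn0 : (0 : ℝ) < n := by
    rcases Nat.eq_zero_or_pos n with rfl | h
    · have := hK 0 le_rfl
      norm_num at hn'
      linarith
    · exact_mod_cast h
  have hn1 : (1 : ℝ) ≤ n := by exact_mod_cast hn0
  have hi : 1 / (n : ℝ) ≤ 1 := (div_le_one hn0).2 hn1
  have h1 := hf.2 (mem_Ici.2 le_rfl) (mem_Ici.2 (by positivity : (0 : ℝ) ≤ n * t))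
    (sub_nonneg.2 hi) (by positivity : (0 : ℝ) ≤ 1 / n) (sub_add_cancel 1 _)
  have h2 : (1 - 1 / (n : ℝ)) • (0 : ℝ) + (1 / (n : ℝ)) • (n * t) = t := by
    simp only [smul_eq_mul]
    field_simp
    ring
  rw [h2] at h1
  simp only [smul_eq_mul] at h1
  have h3 := mul_le_mul_of_nonneg_left h1 hn0.le
  have h4 : (n : ℝ) * ((1 - 1 / n) * f 0 + 1 / n * f (n * t)) = n * f 0 - f 0 + f (n * t) := by
    field_simp
  rw [h4] at h3
  linarith [hK (n * t) (by positivity)]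

/-- A ray as a function of a real parameter. -/
def GeodRay.fn (r : GeodRay X) (t : ℝ) : X := r.1 t.toNNReal

theorem GeodRay.fn_zero (r : GeodRay X) : r.fn 0 = r.1 0 := by
  rw [GeodRay.fn, Real.toNNReal_zero]

theorem GeodRay.geodOn (r : GeodRay X) : GeodOn r.fn (Ici 0) := fun s hs t ht => by
  rw [GeodRay.fn, GeodRay.fn, r.2.dist_eq, NNReal.dist_eq, Real.coe_toNNReal s hs,
    Real.coe_toNNReal t ht]

theorem GeodRay.endpoint_eq_iff {r r' : GeodRay X} :
    r.endpoint = r'.endpoint ↔ ∃ K : ℝ, ∀ t : ℝ, 0 ≤ t → dist (r.fn t) (r'.fn t) ≤ K := by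
  constructor
  · intro h
    obtain ⟨K, hK⟩ := Quotient.exact h
    exact ⟨K, fun t _ => hK _⟩
  · rintro ⟨K, hK⟩
    refine Quotient.sound ⟨K, fun t => ?_⟩
    have := hK t t.2
    rwa [GeodRay.fn, GeodRay.fn, Real.toNNReal_coe] at this

theorem GeodRay.exists_dist_le_of_endpoint_eq {r : GeodRay X} {ζ : GeodLine X}
    (h : r.endpoint = ζ.posEnd) : ∃ K : ℝ, ∀ t : ℝ, 0 ≤ t → dist (r.fn t) (ζ.1 t) ≤ K := by
  obtain ⟨K, hK⟩ := GeodRay.endpoint_eq_iff.1 h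
  refine ⟨K, fun t ht => ?_⟩
  have h1 := hK t ht
  have h2 : GeodRay.fn ⟨⟨fun t : ℝ≥0 => ζ.1 (t : ℝ), ζ.2.continuous.comp NNReal.continuous_coe⟩,
    ζ.2.comp isometry_subtype_coe⟩ t = ζ.1 t := congrArg ζ.1 (Real.coe_toNNReal t ht)
  rwa [h2] at h1

theorem exists_tendsto_ultrafilter [ProperSpace X] {ι : Type*} (F : Ultrafilter ι) (f : ι → X)
    (o : X) (R : ℝ) (h : ∀ᶠ i in F, dist (f i) o ≤ R) : ∃ z, Tendsto f F (𝓝 z) := by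
  obtain ⟨z, -, hz⟩ := (isCompact_closedBall o R).ultrafilter_le_nhds (F.map f)
    (le_principal_iff.2 h)
  exact ⟨z, hz⟩

section CAT0

variable [IsCAT0 X]

theorem GeodRay.dist_le_of_endpoint_eq {r : GeodRay X} {ζ : GeodLine X}
    (h : r.endpoint = ζ.posEnd) (p : ℝ) {t : ℝ} (ht : 0 ≤ t) :
    dist (r.fn t) (ζ.1 (p + t)) ≤ dist (r.1 0) (ζ.1 p) := by
  obtain ⟨K, hK⟩ := GeodRay.exists_dist_le_of_endpoint_eq h
  have := (r.geodOn.convexOn_dist (convex_Ici 0) (ζ.geodOn_add p _)).le_zero_of_bounded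
    (K := K + |p|) (fun t ht => ?_) ht
  · simpa only [GeodRay.fn_zero, add_zero] using this
  · refine (dist_triangle _ (ζ.1 t) _).trans (add_le_add (hK t ht) ?_)
    rw [ζ.dist_eq, sub_add_cancel_right, abs_neg]

/-- Convexity of a distance that vanishes at time `0`. Closeness of rays at one late time thus
controls all earlier times. -/
theorem GeodRay.mul_dist_le {r r' : GeodRay X} (h : r.1 0 = r'.1 0) {t R : ℝ} (ht : 0 ≤ t)
    (htR : t ≤ R) : R * dist (r.fn t) (r'.fn t) ≤ t * dist (r.fn R) (r'.fn R) := by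
  rcases ht.eq_or_lt with rfl | ht0
  · rw [r.fn_zero, r'.fn_zero, h, dist_self, mul_zero, zero_mul]
  have hR : 0 < R := ht0.trans_le htR
  have := (r.geodOn.convexOn_dist (convex_Ici 0) r'.geodOn).2 (mem_Ici.2 le_rfl)
    (mem_Ici.2 hR.le) (sub_nonneg.2 ((div_le_one hR).2 htR)) (div_nonneg ht hR.le)
    (sub_add_cancel 1 _)
  simp only [smul_eq_mul, mul_zero, zero_add, div_mul_cancel₀ _ hR.ne', r.fn_zero, r'.fn_zero, h,
    dist_self] at this
  rw [div_mul_eq_mul_div, le_div_iff₀ hR] at this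
  linarith

theorem GeodRay.eq_of_endpoint_eq {r r' : GeodRay X} (h : r.1 0 = r'.1 0)
    (he : r.endpoint = r'.endpoint) : r = r' := by
  obtain ⟨K, hK⟩ := GeodRay.endpoint_eq_iff.1 he
  refine Subtype.ext (ContinuousMap.ext fun t => ?_)
  have := (r.geodOn.convexOn_dist (convex_Ici 0) r'.geodOn).le_zero_of_bounded hK t.2
  simp only [r.fn_zero, r'.fn_zero, h, dist_self] at this
  have := dist_le_zero.1 this
  rwa [GeodRay.fn, GeodRay.fn, NNReal.val_eq_coe, Real.toNNReal_coe] at this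

/-- Every point of the boundary is the endpoint of a ray from `o`. -/
theorem exists_ray [ProperSpace X] (o : X) (ξ : VisualBoundary X) :
    ∃ r : GeodRay X, r.1 0 = o ∧ r.endpoint = ξ := by
  induction ξ using Quotient.inductionOn with
  | h r₀ =>
  set d₀ := dist o (r₀.1 0) with hd₀
  -- The ray is the pointwise ultralimit of the geodesics from `o` to `r₀ n`, whose lengths differ
  -- from `n` by at most `d₀`.
  choose c hc0 hc1 hc using fun n : ℕ => IsCAT0.exists_geodesic o (r₀.fn n)
  have hlen : ∀ n : ℕ, |dist o (r₀.fn n) - n| ≤ d₀ := fun n => by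
    have h1 : dist (r₀.fn 0) (r₀.fn n) = n := by
      rw [r₀.geodOn 0 (mem_Ici.2 le_rfl) n (mem_Ici.2 n.cast_nonneg), zero_sub, abs_neg,
        abs_of_nonneg n.cast_nonneg]
    have h2 := dist_triangle o (r₀.fn 0) (r₀.fn n)
    have h3 := dist_triangle_left (r₀.fn 0) (r₀.fn n) o
    rw [r₀.fn_zero] at h1 h2 h3
    exact abs_le.2 ⟨by linarith, by linarith⟩
  have hev : ∀ t : ℝ, ∀ᶠ n : ℕ in (hyperfilter ℕ : Filter ℕ), t + d₀ ≤ n ∧ 1 ≤ n := fun t =>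
    Nat.hyperfilter_le_atTop ((tendsto_natCast_atTop_atTop.eventually_ge_atTop (t + d₀)).and
      (eventually_ge_atTop 1))
  have hmem : ∀ t : ℝ, 0 ≤ t → ∀ n : ℕ, t + d₀ ≤ n → t ∈ Icc 0 (dist o (r₀.fn n)) :=
    fun t ht n hn => ⟨ht, by linarith [(abs_le.1 (hlen n)).1]⟩
  have hlim : ∀ t : ℝ≥0, ∃ z, Tendsto (fun n => c n t) (hyperfilter ℕ : Filter ℕ) (𝓝 z) :=
    fun t => exists_tendsto_ultrafilter _ _ o t <| by
      filter_upwards [hev t] with n hn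
      have := hc n t (hmem t t.2 n hn.1) 0 (left_mem_Icc.2 dist_nonneg)
      rw [hc0, sub_zero, abs_of_nonneg t.coe_nonneg] at this
      exact this.le
  choose f hf using hlim
  have hiso : Isometry f := Isometry.of_dist_eq fun s t => by
    refine tendsto_nhds_unique ((hf s).dist (hf t)) (tendsto_const_nhds.congr' ?_)
    filter_upwards [hev s, hev t] with n hs ht
    rw [hc n s (hmem s s.2 n hs.1) t (hmem t t.2 n ht.1), NNReal.dist_eq]
  refine ⟨⟨⟨f, hiso.continuous⟩, hiso⟩, ?_, ?_⟩
  · refine tendsto_nhds_unique (hf 0) (tendsto_const_nhds.congr fun n => ?_)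
    rw [NNReal.coe_zero, hc0]
  · refine Quotient.sound ⟨2 * d₀, fun t => ?_⟩
    refine le_of_tendsto ((hf t).dist tendsto_const_nhds) ?_
    filter_upwards [hev t] with n hn
    have hd : 0 ≤ d₀ := dist_nonneg
    have hn0 : (0 : ℝ) < n := by exact_mod_cast hn.2
    have hs : (t : ℝ) / n ∈ Icc (0 : ℝ) 1 :=
      ⟨div_nonneg t.2 hn0.le, (div_le_one hn0).2 (by linarith [hn.1])⟩
    -- The points dividing both geodesics in the ratio given by `t / n` are at most `d₀` apart; the
    -- mismatch of parameters contributes another `d₀`.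
    have e1 := (GeodOn.divides (hc n) (convex_Icc _ _) (left_mem_Icc.2 dist_nonneg)
      (right_mem_Icc.2 dist_nonneg) hs).dist_le hs
      (r₀.geodOn.divides (convex_Ici 0) (mem_Ici.2 le_rfl) (mem_Ici.2 hn0.le) hs)
    simp only [hc0, hc1, dist_self, mul_zero, add_zero, zero_add, div_mul_cancel₀ _ hn0.ne',
      r₀.fn_zero, ← hd₀] at e1
    have hm : (t : ℝ) / n * dist o (r₀.fn n) ∈ Icc 0 (dist o (r₀.fn n)) :=
      ⟨mul_nonneg hs.1 dist_nonneg, mul_le_of_le_one_left dist_nonneg hs.2⟩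
    have e2 := hc n t (hmem t t.2 n hn.1) _ hm
    have e3 : |(t : ℝ) - t / n * dist o (r₀.fn n)| ≤ d₀ := by
      have : (t : ℝ) - t / n * dist o (r₀.fn n) = t / n * (n - dist o (r₀.fn n)) := by
        field_simp
      rw [this, abs_mul, abs_of_nonneg hs.1, abs_sub_comm]
      exact (mul_le_mul hs.2 (hlen n) (abs_nonneg _) zero_le_one).trans_eq (one_mul _)
    have e4 : (1 - (t : ℝ) / n) * d₀ ≤ d₀ :=
      mul_le_of_le_one_left hd (by linarith [hs.1])
    have e5 : r₀.fn t = r₀.1 t := by rw [GeodRay.fn, Real.toNNReal_coe]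
    rw [e5] at e1
    have := dist_triangle (c n t) (c n ((t : ℝ) / n * dist o (r₀.fn n))) (r₀.1 t)
    linarith

variable [ProperSpace X]

/-- The rays from `o` correspond to the points of the boundary. -/
def rayEquiv (o : X) : {r : GeodRay X // r.1 0 = o} ≃ VisualBoundary X :=
  Equiv.ofBijective (fun r => GeodRay.endpoint r.1)
    ⟨fun r r' h => Subtype.ext (GeodRay.eq_of_endpoint_eq (r.2.trans r'.2.symm) h), fun ξ =>
      let ⟨r, h, h'⟩ := exists_ray o ξ
      ⟨⟨r, h⟩, h'⟩⟩

/-- The ray from `o` to `ξ`. -/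
def rayTo (o : X) (ξ : VisualBoundary X) : GeodRay X := ((rayEquiv o).symm ξ).1

theorem rayTo_zero (o : X) (ξ : VisualBoundary X) : (rayTo o ξ).1 0 = o :=
  ((rayEquiv o).symm ξ).2

theorem endpoint_rayTo (o : X) (ξ : VisualBoundary X) : (rayTo o ξ).endpoint = ξ :=
  (rayEquiv o).apply_symm_apply ξ

/-- A topology coinduced along a bijection is induced along its inverse, so convergence in `∂X` can
be tested on rays from `o`. -/
theorem coneTopology_eq_induced (o : X) :
    coneTopology o = TopologicalSpace.induced (rayTo o) inferInstance := by
  have h : coneTopology o = TopologicalSpace.coinduced (rayEquiv o) inferInstance := rfl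
  rw [h, ← Equiv.induced_symm, show rayTo o = Subtype.val ∘ (rayEquiv o).symm from rfl,
    ← induced_compose]
  rfl

theorem tendsto_rayTo {o : X} {ξ : VisualBoundary X} {ι : Type*} {F : Filter ι}
    {η : ι → VisualBoundary X}
    (h : ∀ R, 0 < R → ∀ ε, 0 < ε → ∀ᶠ i in F, dist ((rayTo o ξ).fn R) ((rayTo o (η i)).fn R) < ε) :
    Tendsto (fun i => rayTo o (η i)) F (𝓝 (rayTo o ξ)) := by
  rw [tendsto_subtype_rng, ContinuousMap.tendsto_iff_forall_isCompact_tendstoUniformlyOn]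
  intro K hK
  rw [Metric.tendstoUniformlyOn_iff]
  intro ε hε
  obtain ⟨R, hR⟩ := hK.bddAbove
  have hR' : (0 : ℝ) < R + 1 := by positivity
  filter_upwards [h (R + 1) hR' ε hε] with i hi t ht
  have htR : (t : ℝ) ≤ R + 1 := by
    have : (t : ℝ) ≤ R := hR ht
    linarith
  have h1 := GeodRay.mul_dist_le ((rayTo_zero o ξ).trans (rayTo_zero o (η i)).symm) t.2 htR
  rw [NNReal.val_eq_coe, GeodRay.fn, GeodRay.fn, Real.toNNReal_coe] at h1
  have h2 : ((R : ℝ) + 1) * dist ((rayTo o ξ).1 t) ((rayTo o (η i)).1 t) ≤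
      (R + 1) * dist ((rayTo o ξ).fn (R + 1)) ((rayTo o (η i)).fn (R + 1)) :=
    h1.trans (mul_le_mul_of_nonneg_right htR dist_nonneg)
  exact (le_of_mul_le_mul_left h2 hR').trans_lt hi

theorem rayTo_dist_lt_mem_nhds (o : X) (ξ : VisualBoundary X) (R : ℝ) {ε : ℝ} (hε : 0 < ε) :
    {r : GeodRay X | dist ((rayTo o ξ).fn R) (r.fn R) < ε} ∈ 𝓝 (rayTo o ξ) := by
  have hc : Continuous fun r : GeodRay X => r.fn R :=
    (continuous_eval_const (F := C(ℝ≥0, X)) R.toNNReal).comp continuous_subtype_val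
  have := (continuous_const (y := (rayTo o ξ).fn R)).dist hc |>.continuousAt (x := rayTo o ξ)
  exact this.eventually_lt continuousAt_const (by rwa [dist_self])

end CAT0

end

section

variable {X : Type u} [MetricSpace X]

/-! ### Convergence of endpoints and fellow travelling -/

theorem GeodLine.IsContracting.reverse {B : ℝ} {γ : GeodLine X} (h : γ.IsContracting B) :
    γ.reverse.IsContracting B :=
  (GeodLine.ContractingJoins.reverse (α := (γ.negEnd, γ.posEnd)) ⟨h, rfl, rfl⟩).1

variable [IsCAT0 X]

theorem abs_projParam_le (γ : GeodLine X) (p : X) : |γ.projParam p| ≤ dist p (γ.1 0) := by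
  have := γ.abs_projParam_sub_le p (γ.1 0)
  rwa [γ.projParam_apply, sub_zero] at this

/-- A ray that comes close to `γ(R)` projects from then on to the part of `γ` behind `γ(R)`, up to a
bounded amount. -/
theorem GeodLine.IsContracting.le_projParam_ray {B : ℝ} (hB : 0 < B) {γ : GeodLine X}
    (h : γ.IsContracting B) {ρ : GeodRay X} {M R : ℝ} (hM : dist (ρ.1 0) (γ.1 0) ≤ M)
    (hR : dist (ρ.fn R) (γ.1 R) ≤ M + 1) (hRM : 3 * M + 12 * B + 3 ≤ R) {t : ℝ} (ht : R ≤ t) :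
    R - 12 * B - 2 - 2 * M ≤ γ.projParam (ρ.fn t) := by
  have hM0 : 0 ≤ M := dist_nonneg.trans hM
  have hR0 : 0 ≤ R := by linarith
  have hgeod : GeodOn ρ.fn (Icc R t) := ρ.geodOn.mono fun s hs => mem_Ici.2 (hR0.trans hs.1)
  have e1 : |γ.projParam (ρ.fn R) - R| ≤ M + 1 := by
    have := (γ.abs_projParam_sub_le (ρ.fn R) (γ.1 R)).trans hR
    rwa [γ.projParam_apply] at this
  have e2 := (γ.infDist_le (ρ.fn R) R).trans hR
  have e3 := (abs_projParam_le γ (ρ.1 0)).trans hM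
  have e4 := (γ.infDist_le (ρ.1 0) 0).trans hM
  -- At time `s` the ray is at distance `s` from its origin, so it cannot be both close to `γ` and
  -- projected near `γ 0`.
  have far : ∀ s, R ≤ s → s ≤ Metric.infDist (ρ.fn s) (range γ.1) + |γ.projParam (ρ.fn s)| +
      2 * M := by
    intro s hs
    have h1 := γ.dist_le_abs_projParam_sub (ρ.fn s) (ρ.1 0)
    rw [← ρ.fn_zero, ρ.geodOn s (mem_Ici.2 (hR0.trans hs)) 0 (mem_Ici.2 le_rfl), sub_zero,
      abs_of_nonneg (hR0.trans hs), ρ.fn_zero] at h1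
    have h2 := abs_sub (γ.projParam (ρ.fn s)) (γ.projParam (ρ.1 0))
    linarith
  by_contra! hlt
  have hclose := h.exists_close hB ht hgeod (by
    refine lt_of_lt_of_le ?_ (le_abs_self _)
    linarith [(abs_le.1 e1).1])
  obtain ⟨t₁, ht₁, f1, f2⟩ := h.exists_last_close hB hgeod hclose
  have g1 := far t₁ ht₁.1
  have f2' := (abs_le.1 f2).2
  rcases le_or_gt 0 (γ.projParam (ρ.fn t₁)) with hs | hs
  · rw [abs_of_nonneg hs] at g1
    linarith [ht₁.1]
  -- If the projection has become negative it has crossed `0` at some `t₂`; convexity keeps the ray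
  -- close to `γ` there, contradicting `far`.
  · have hgeod' : GeodOn ρ.fn (Icc R t₁) := hgeod.mono (Icc_subset_Icc_right ht₁.2)
    have hcont : ContinuousOn (fun s => γ.projParam (ρ.fn s)) (Icc R t₁) :=
      γ.continuous_projParam.comp_continuousOn hgeod'.continuousOn
    obtain ⟨t₂, ht₂, hz⟩ := intermediate_value_Icc' ht₁.1 hcont
      (show (0 : ℝ) ∈ Icc _ _ from ⟨hs.le, by linarith [(abs_le.1 e1).1]⟩)
    have g2 := far t₂ ht₂.1
    have hz' : γ.projParam (ρ.fn t₂) = 0 := hz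
    rw [hz', abs_zero] at g2
    have hconv := (hgeod'.convexOn_infDist (convex_Icc R t₁) γ).le_max_of_mem_Icc
      (left_mem_Icc.2 ht₁.1) (right_mem_Icc.2 ht₁.1) ht₂
    have hle : max (Metric.infDist (ρ.fn R) (range γ.1)) (Metric.infDist (ρ.fn t₁) (range γ.1)) ≤
      M + 1 + (6 * B + 1) := max_le (by linarith) (by linarith)
    have := hconv.trans hle
    linarith [ht₂.1]

/-- Transfers the estimate from the ray to an asymptotic line at distance at most `D`. If the ray
ever leaves the `D`-neighbourhood of `γ`, contraction makes the transfer cost only `B`; otherwise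
its projection grows without bound and eventually absorbs `D`. -/
theorem GeodLine.IsContracting.exists_le_projParam {B : ℝ} (hB : 0 < B) {γ ζ : GeodLine X}
    (h : γ.IsContracting B) {ρ : GeodRay X} {M R : ℝ} (hM : dist (ρ.1 0) (γ.1 0) ≤ M)
    (hR : dist (ρ.fn R) (γ.1 R) ≤ M + 1) (hRM : 3 * M + 12 * B + 3 ≤ R)
    (hρ : ρ.endpoint = ζ.posEnd) :
    ∃ u, 0 ≤ u ∧ R - 13 * B - 2 - 2 * M ≤ γ.projParam (ζ.1 u) := by
  have hM0 : 0 ≤ M := dist_nonneg.trans hM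
  have hR0 : 0 ≤ R := by linarith
  obtain ⟨D, hD⟩ := GeodRay.exists_dist_le_of_endpoint_eq hρ
  have key : ∀ t, R ≤ t → R - 12 * B - 2 - 2 * M ≤ γ.projParam (ρ.fn t) := fun t ht =>
    h.le_projParam_ray hB hM hR hRM ht
  by_cases hcase : ∃ t, R ≤ t ∧ D < Metric.infDist (ρ.fn t) (range γ.1)
  · obtain ⟨t, ht, hlt⟩ := hcase
    have h1 := h.abs_projParam_sub_le hB.le hlt (hD t (hR0.trans ht))
    exact ⟨t, hR0.trans ht, by linarith [(abs_le.1 h1).2, key t ht]⟩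
  · push Not at hcase
    have hD0 : 0 ≤ D := dist_nonneg.trans (hD 0 le_rfl)
    set t := R + 2 * D + 2 * M
    have ht : R ≤ t := by simp only [t]; linarith
    have h1 := γ.dist_le_abs_projParam_sub (ρ.fn t) (ρ.1 0)
    rw [← ρ.fn_zero, ρ.geodOn t (mem_Ici.2 (hR0.trans ht)) 0 (mem_Ici.2 le_rfl), sub_zero,
      abs_of_nonneg (hR0.trans ht), ρ.fn_zero] at h1
    have h2 := abs_sub (γ.projParam (ρ.fn t)) (γ.projParam (ρ.1 0))
    have h3 := (abs_projParam_le γ (ρ.1 0)).trans hM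
    have h4 := (γ.infDist_le (ρ.1 0) 0).trans hM
    have h5 := hcase t ht
    have h6 := key t ht
    rw [abs_of_nonneg (by linarith : 0 ≤ γ.projParam (ρ.fn t))] at h2
    have h7 := (abs_le.1 ((γ.abs_projParam_sub_le _ _).trans (hD t (hR0.trans ht)))).2
    refine ⟨t, hR0.trans ht, ?_⟩
    have : t = R + 2 * D + 2 * M := rfl
    linarith

/-- A line that has points with projections to `γ` far out on both sides fellow travels `γ`. -/
theorem GeodLine.IsContracting.fellow_of_projParam_le {B : ℝ} (hB : 0 < B) {γ ζ : GeodLine X}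
    (h : γ.IsContracting B) {u₀ u₁ S : ℝ} (hu : u₀ ≤ u₁) (hS : 6 * B < S)
    (h₀ : γ.projParam (ζ.1 u₀) ≤ -S) (h₁ : S ≤ γ.projParam (ζ.1 u₁)) (x : X) :
    Fellow (24 * B + 8 + dist x (γ.1 0)) (S - (18 * B + 4 + 2 * dist x (γ.1 0))) x ζ γ := by
  have hgeod := ζ.geodOn (Icc u₀ u₁)
  have hclose := h.exists_close hB hu hgeod (by
    rw [abs_sub_comm]
    refine lt_of_lt_of_le ?_ (le_abs_self _)
    linarith)
  obtain ⟨t₀, ht₀, f0, g0⟩ := h.exists_first_close hB hgeod hclose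
  obtain ⟨t₁, ht₁, f1, g1⟩ := h.exists_last_close hB (ζ.geodOn (Icc t₀ u₁))
    ⟨t₀, left_mem_Icc.2 ht₀.2, f0⟩
  have g0' := (abs_le.1 g0).1
  have g1' := (abs_le.1 g1).1
  have m0 : t₀ ∈ fellowSet B ζ γ := show Metric.infDist _ _ ≤ _ by linarith
  have m1 : t₁ ∈ fellowSet B ζ γ := show Metric.infDist _ _ ≤ _ by linarith
  have hord := (ordConnected_fellowSet B ζ γ).out m0 m1
  have hlip := ζ.abs_projParam_apply_sub_le γ
  have hcont : ContinuousOn (fun s => γ.projParam (ζ.1 s)) (Icc t₀ t₁) :=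
    (γ.continuous_projParam.comp ζ.2.continuous).continuousOn
  -- The point of `ζ` projecting to `γ 0` lies in the middle of the close arc, and the projection of
  -- `x` to `ζ` is near it, by `2N + 2 (6B + 2)`.
  obtain ⟨t₂, ht₂, hz⟩ := intermediate_value_Icc ht₁.1 hcont
    (show (0 : ℝ) ∈ Icc _ _ from ⟨by linarith, by linarith⟩)
  have hz' : γ.projParam (ζ.1 t₂) = 0 := hz
  have m2 : Metric.infDist (ζ.1 t₂) (range γ.1) ≤ 6 * B + 2 := hord ht₂
  rw [γ.infDist_eq, hz'] at m2
  set p := ζ.projParam x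
  set N := dist x (γ.1 0)
  have e1 : dist x (ζ.1 p) ≤ N + (6 * B + 2) :=
    (ζ.dist_projParam_le x t₂).trans ((dist_triangle_right _ _ _).trans (add_le_add_right m2 _))
  have e2 : |t₂ - p| ≤ 2 * N + 2 * (6 * B + 2) := by
    rw [← ζ.dist_eq]
    have h1 := dist_triangle_right (ζ.1 t₂) x (γ.1 0)
    have h2 := dist_triangle (ζ.1 t₂) x (ζ.1 p)
    linarith
  have e3 : |γ.projParam (ζ.1 p) - γ.projParam x| ≤ N + (6 * B + 2) := by
    refine (γ.abs_projParam_sub_le _ _).trans ?_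
    rwa [dist_comm]
  have e4 : S - 6 * B ≤ t₂ - t₀ := by
    have := (le_abs_self _).trans (hlip t₂ t₀)
    rw [hz', abs_of_nonneg (by linarith [ht₂.1])] at this
    linarith
  have e5 : S - 6 * B ≤ t₁ - t₂ := by
    have := (le_abs_self _).trans (hlip t₁ t₂)
    rw [hz', abs_of_nonneg (by linarith [ht₂.2])] at this
    linarith
  have e6 := abs_le.1 e2
  intro t ht
  set T := S - (18 * B + 4 + 2 * N) with hT
  have hT0 : 0 ≤ T := (abs_nonneg t).trans ht
  have hp0 : t₀ ≤ p - T := by linarith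
  have hp1 : p + T ≤ t₁ := by linarith
  have := dist_le_of_infDist_le (ζ := ζ) (ζ' := γ) (p := p) (p' := γ.projParam x) (T := T)
    (K := 6 * B + 2) (M := N + (6 * B + 2)) (fun s hs => hord ⟨by linarith [(abs_le.1 hs).1],
      by linarith [(abs_le.1 hs).2]⟩) ?_ e3 ht
  · linarith
  · have h1 := abs_sub_le_of_mem_fellowSet m1 m0
    rw [abs_of_nonneg (by linarith [ht₁.1]), abs_of_nonneg (by linarith)] at h1
    have h2 := (le_abs_self _).trans (hlip t₁ (p + T))
    have h3 := (le_abs_self _).trans (hlip (p - T) t₀)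
    rw [abs_of_nonneg (by linarith)] at h2 h3
    linarith

variable [ProperSpace X]

theorem dist_rayTo_le_of_joins {o : X} {ξ : VisualBoundary X} {ζ : GeodLine X} (h : ζ.posEnd = ξ)
    (p : ℝ) {t : ℝ} (ht : 0 ≤ t) : dist ((rayTo o ξ).fn t) (ζ.1 (p + t)) ≤ dist o (ζ.1 p) := by
  have := GeodRay.dist_le_of_endpoint_eq ((endpoint_rayTo o ξ).trans h.symm) p ht
  rwa [rayTo_zero] at this

/-- If the rays to the endpoints are close for a long time, then `τ_B` is large. -/
theorem exists_le_tau_of_dist_rayTo_lt {B : ℝ} (hB : 0 < B) (x o : X) (α : ContractingPairs X B)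
    (T : ℝ) : ∃ R, ∀ β : ContractingPairs X B,
      dist ((rayTo o α.1.1).fn R) ((rayTo o β.1.1).fn R) < 1 →
      dist ((rayTo o α.1.2).fn R) ((rayTo o β.1.2).fn R) < 1 →
      ENNReal.ofReal T ≤ tau B x α.1 β.1 := by
  obtain ⟨γ, hγ⟩ := α.2
  set M := dist o (γ.1 0)
  set N := dist x (γ.1 0)
  have hM : 0 ≤ M := dist_nonneg
  have hN : 0 ≤ N := dist_nonneg
  set K := 24 * B + 8 + N
  have hK : 0 ≤ K := by positivity
  -- The summands pay for `Fellow.le_tau`, for `fellow_of_projParam_le`, and for passing from the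
  -- rays to the line `ζ`.
  set R := |T| + (4 * K + 316 * B + 111) + (18 * B + 4 + 2 * N) + (25 * B + 3 + 3 * M) with hRdef
  have hR : 3 * M + 12 * B + 3 ≤ R := by linarith [abs_nonneg T]
  have hR0 : 0 ≤ R := by linarith
  refine ⟨R, fun β h1 h2 => ?_⟩
  obtain ⟨ζ, hζ⟩ := β.2
  have d2 : dist ((rayTo o β.1.2).fn R) (γ.1 R) ≤ M + 1 := by
    have := dist_rayTo_le_of_joins (o := o) hγ.2.2 0 hR0
    rw [zero_add] at this
    linarith [dist_triangle_left ((rayTo o β.1.2).fn R) (γ.1 R) ((rayTo o α.1.2).fn R)]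
  have d1 : dist ((rayTo o β.1.1).fn R) (γ.reverse.1 R) ≤ M + 1 := by
    have := dist_rayTo_le_of_joins (o := o) hγ.2.1 0 hR0
    rw [zero_add, γ.reverse_apply 0, neg_zero] at this
    linarith [dist_triangle_left ((rayTo o β.1.1).fn R) (γ.reverse.1 R) ((rayTo o α.1.1).fn R)]
  obtain ⟨u₁, hu₁, e1⟩ := hγ.1.exists_le_projParam hB (ζ := ζ) (M := M)
    (by rw [rayTo_zero]) d2 hR ((endpoint_rayTo o _).trans hζ.2.2.symm)
  obtain ⟨u₀, hu₀, e0⟩ := hγ.1.reverse.exists_le_projParam hB (ζ := ζ.reverse) (M := M)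
    (by rw [rayTo_zero, γ.reverse_apply, neg_zero]) d1 hR
    ((endpoint_rayTo o _).trans hζ.2.1.symm)
  rw [γ.projParam_reverse, ζ.reverse_apply] at e0
  have hf := hγ.1.fellow_of_projParam_le hB (S := R - 13 * B - 2 - 2 * M) (u₀ := -u₀) (u₁ := u₁)
    (by linarith) (by linarith [abs_nonneg T]) (by linarith) e1 x
  refine le_trans (ENNReal.ofReal_le_ofReal ?_) (hf.symm.le_tau hB hγ hζ hK)
  linarith [le_abs_self T]

theorem exists_dist_rayTo_posEnd_lt {B : ℝ} (hB : 0 < B) (x o : X) (α : ContractingPairs X B)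
    {R ε : ℝ} (hR : 0 < R) (hε : 0 < ε) : ∃ T, ∀ β : ContractingPairs X B,
      ENNReal.ofReal T ≤ tau B x α.1 β.1 →
      dist ((rayTo o α.1.2).fn R) ((rayTo o β.1.2).fn R) < ε := by
  obtain ⟨ζ₁, h₁⟩ := α.2
  set M := dist o (ζ₁.1 (ζ₁.projParam x))
  have hM : 0 ≤ M := dist_nonneg
  set K := 37 * B + 13
  have hK : 0 ≤ K := by positivity
  have hq : 0 ≤ R * (2 * M + 2 * K) / ε := by positivity
  -- At time `T` the rays are within `2M + 2K`; scaling back to time `R` multiplies this by `R / T`.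
  set T := 18 * B + 7 + R + R * (2 * M + 2 * K) / ε with hT
  refine ⟨T, fun β h => ?_⟩
  obtain ⟨ζ₂, h₂⟩ := β.2
  have hT0 : 0 < T := by positivity
  have hf := fellow_of_le_tau hB h₁ h₂ (by linarith) h
  have f0 := hf 0 (by rw [abs_zero]; exact hT0.le)
  have fT := hf T (by rw [abs_of_pos hT0])
  rw [add_zero, add_zero] at f0
  have r1 := dist_rayTo_le_of_joins (o := o) h₁.2.2 (ζ₁.projParam x) hT0.le
  have r2 := dist_rayTo_le_of_joins (o := o) h₂.2.2 (ζ₂.projParam x) hT0.le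
  have r3 := dist_triangle o (ζ₁.1 (ζ₁.projParam x)) (ζ₂.1 (ζ₂.projParam x))
  have r4 : dist ((rayTo o α.1.2).fn T) ((rayTo o β.1.2).fn T) ≤ 2 * M + 2 * K := by
    have h3 := dist_triangle4 ((rayTo o α.1.2).fn T) (ζ₁.1 (ζ₁.projParam x + T))
      (ζ₂.1 (ζ₂.projParam x + T)) ((rayTo o β.1.2).fn T)
    rw [dist_comm (ζ₂.1 _) ((rayTo o β.1.2).fn T)] at h3
    linarith
  have r5 := GeodRay.mul_dist_le (r := rayTo o α.1.2) (r' := rayTo o β.1.2)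
    ((rayTo_zero o _).trans (rayTo_zero o _).symm) hR.le (by linarith : R ≤ T)
  have r6 := mul_le_mul_of_nonneg_left r4 hR.le
  have r7 : R * (2 * M + 2 * K) < T * ε := by
    rw [← div_lt_iff₀ hε]
    linarith
  exact lt_of_mul_lt_mul_left (r5.trans_lt (r6.trans_lt r7)) hT0.le

/-- If `τ_B` is large, then the rays to the endpoints are close for a long time. -/
theorem exists_dist_rayTo_lt_of_le_tau {B : ℝ} (hB : 0 < B) (x o : X) (α : ContractingPairs X B)
    {R ε : ℝ} (hR : 0 < R) (hε : 0 < ε) : ∃ T, ∀ β : ContractingPairs X B,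
      ENNReal.ofReal T ≤ tau B x α.1 β.1 →
      dist ((rayTo o α.1.1).fn R) ((rayTo o β.1.1).fn R) < ε ∧
      dist ((rayTo o α.1.2).fn R) ((rayTo o β.1.2).fn R) < ε := by
  obtain ⟨T, hT⟩ := exists_dist_rayTo_posEnd_lt hB x o α hR hε
  obtain ⟨T', hT'⟩ := exists_dist_rayTo_posEnd_lt hB x o (ContractingPairs.flip α) hR hε
  refine ⟨max T T', fun β h => ⟨?_, hT β (le_trans (ENNReal.ofReal_le_ofReal (le_max_left _ _)) h)⟩⟩
  refine hT' (ContractingPairs.flip β) ?_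
  exact (le_trans (ENNReal.ofReal_le_ofReal (le_max_right _ _)) h).trans_eq (tau_swap B x _ _).symm

end

section

variable {X : Type u} [MetricSpace X] [IsCAT0 X]

/-! ### Limits of contracting lines -/

/-- The projections to a pointwise limit of lines are the limits of the projections. -/
theorem tendsto_projParam_sub {ι : Type*} {F : Ultrafilter ι} {ζ : ι → GeodLine X} {x : X}
    {γ : GeodLine X}
    (h : ∀ t, Tendsto (fun i => (ζ i).1 ((ζ i).projParam x + t)) F (𝓝 (γ.1 t))) (y : X) :
    Tendsto (fun i => (ζ i).projParam y - (ζ i).projParam x) F (𝓝 (γ.projParam y)) ∧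
      Tendsto (fun i => Metric.infDist y (range (ζ i).1)) F (𝓝 (Metric.infDist y (range γ.1))) := by
  obtain ⟨q, hq⟩ := exists_tendsto_ultrafilter F
    (fun i => (ζ i).projParam y - (ζ i).projParam x) 0 (dist y x) (Eventually.of_forall fun i => by
      rw [Real.dist_eq, sub_zero]
      exact (ζ i).abs_projParam_sub_le y x)
  -- The limit of the nearest points lies on `γ` and inherits minimality, so it is the nearest
  -- point.
  have hlim : Tendsto (fun i => (ζ i).1 ((ζ i).projParam y)) F (𝓝 (γ.1 q)) := by
    rw [tendsto_iff_dist_tendsto_zero] at hq ⊢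
    have hsum := hq.add (tendsto_iff_dist_tendsto_zero.1 (h q))
    rw [add_zero] at hsum
    refine squeeze_zero (fun _ => dist_nonneg) (fun i => ?_) hsum
    refine (dist_triangle _ ((ζ i).1 ((ζ i).projParam x + q)) _).trans_eq ?_
    rw [(ζ i).dist_eq, Real.dist_eq, sub_add_eq_sub_sub]
  have hmin : γ.projParam y = q := γ.projParam_eq fun u =>
    le_of_tendsto_of_tendsto (tendsto_const_nhds.dist hlim) (tendsto_const_nhds.dist (h u))
      (Eventually.of_forall fun i => (ζ i).dist_projParam_le y _)
  refine ⟨hmin ▸ hq, ?_⟩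
  simp only [GeodLine.infDist_eq, hmin]
  exact tendsto_const_nhds.dist hlim

/-- A closed ball disjoint from `γ` is disjoint from the lines near the limit, as distances to the
lines converge; the bound on projections then passes to the limit. -/
theorem isContracting_of_tendsto {B : ℝ} (hB : 0 < B) {ι : Type*} {F : Ultrafilter ι}
    {ζ : ι → GeodLine X} (hζ : ∀ i, (ζ i).IsContracting B) {x : X} {γ : GeodLine X}
    (h : ∀ t, Tendsto (fun i => (ζ i).1 ((ζ i).projParam x + t)) F (𝓝 (γ.1 t))) :
    γ.IsContracting B := by
  intro p r hd
  have hr : r < Metric.infDist p (range γ.1) := by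
    rw [γ.infDist_eq, ← not_le]
    intro hle
    exact Set.disjoint_left.1 hd (by rwa [Metric.mem_closedBall, dist_comm])
      (mem_range_self (γ.projParam p))
  have hev := (tendsto_projParam_sub h p).2.eventually_const_lt hr
  refine Metric.ediam_le fun a ha b hb => ?_
  simp only [mem_iUnion] at ha hb
  obtain ⟨y, hy, ⟨s, rfl⟩, hs⟩ := ha
  obtain ⟨z, hz, ⟨t, rfl⟩, ht⟩ := hb
  rw [edist_dist, ENNReal.ofReal_le_ofReal_iff hB.le, γ.dist_eq,
    ← γ.projParam_eq fun u => hs _ (mem_range_self u),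
    ← γ.projParam_eq fun u => ht _ (mem_range_self u)]
  refine le_of_tendsto ((tendsto_projParam_sub h y).1.sub (tendsto_projParam_sub h z).1).abs ?_
  filter_upwards [hev] with i hi
  rw [sub_sub_sub_cancel_right]
  exact (hζ i).abs_projParam_sub_le_of_mem_ball hB.le hi (by rwa [dist_comm]) (by rwa [dist_comm])

/-- Based at the projections of `x`, the lines stay near one line, so properness gives an ultralimit
line. Closeness at the two times `±S` implies fellow travelling in between by convexity. -/
theorem exists_eventually_le_tau [ProperSpace X] {B : ℝ} (hB : 0 < B) {x : X}
    {α : ContractingPairs X B} (F : Ultrafilter (ContractingPairs X B)) {T : ℝ}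
    (hT : 18 * B + 6 < T) (hF : ∀ᶠ β : ContractingPairs X B in F,
      ENNReal.ofReal T ≤ tau B x α.1 β.1) :
    ∃ η : ContractingPairs X B, ∀ T' : ℝ, ∀ᶠ β : ContractingPairs X B in F,
      ENNReal.ofReal T' ≤ tau B x η.1 β.1 := by
  obtain ⟨ζ₀, h₀⟩ := α.2
  choose ζ hζ using fun β : ContractingPairs X B => β.2
  have hlim : ∀ t, ∃ z, Tendsto (fun β => (ζ β).1 ((ζ β).projParam x + t)) F (𝓝 z) := fun t => by
    refine exists_tendsto_ultrafilter F _ (ζ₀.1 (ζ₀.projParam x)) (|t| + (37 * B + 13)) ?_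
    filter_upwards [hF] with β hβ
    have h1 := fellow_of_le_tau hB h₀ (hζ β) hT hβ 0 (by rw [abs_zero]; linarith)
    rw [add_zero, add_zero, dist_comm] at h1
    refine (dist_triangle _ ((ζ β).1 ((ζ β).projParam x)) _).trans (add_le_add ?_ h1)
    rw [(ζ β).dist_eq, add_sub_cancel_left]
  choose f hf using hlim
  have hiso : Isometry f := Isometry.of_dist_eq fun s t => by
    refine tendsto_nhds_unique ((hf s).dist (hf t)) (tendsto_const_nhds.congr fun β => ?_)
    rw [(ζ β).dist_eq, add_sub_add_left_eq_sub, Real.dist_eq]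
  have hc := isContracting_of_tendsto hB (γ := ⟨f, hiso⟩) (fun β => (hζ β).1) hf
  have hx : GeodLine.projParam ⟨f, hiso⟩ x = 0 := by
    have := (tendsto_projParam_sub (γ := ⟨f, hiso⟩) hf x).1
    simp only [sub_self] at this
    exact tendsto_nhds_unique this tendsto_const_nhds
  have hj : GeodLine.ContractingJoins B ⟨f, hiso⟩
    (GeodLine.negEnd ⟨f, hiso⟩, GeodLine.posEnd ⟨f, hiso⟩) := ⟨hc, rfl, rfl⟩
  refine ⟨⟨_, _, hj⟩, fun T' => ?_⟩
  set S := T' + (4 * 1 + 316 * B + 111)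
  have hev : ∀ t, ∀ᶠ β in F, dist (f t) ((ζ β).1 ((ζ β).projParam x + t)) ≤ 1 := fun t => by
    have := (tendsto_iff_dist_tendsto_zero.1 (hf t)).eventually_le_const zero_lt_one
    simpa only [dist_comm] using this
  filter_upwards [hev S, hev (-S)] with β h1 h2
  have hfel : Fellow 1 S x ⟨f, hiso⟩ (ζ β) := fun t ht => by
    rw [hx, zero_add]
    have hconv := (GeodLine.geodOn ⟨f, hiso⟩ univ).convexOn_dist convex_univ
      ((ζ β).geodOn_add ((ζ β).projParam x) univ)
    exact (hconv.le_max_of_mem_Icc (mem_univ (-S)) (mem_univ S) (abs_le.1 ht)).trans (max_le h2 h1)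
  have := hfel.le_tau hB hj (hζ β) zero_le_one
  rwa [add_sub_cancel_right] at this

end

section

variable {A : Type*} {ρ : A → A → ℝ}

/-! ### Metrics from quasi-ultrametrics -/

/-- There is a chain with `n` links and total length `s` from `x` to `y`. -/
inductive ChainSum (ρ : A → A → ℝ) : ℕ → A → A → ℝ → Prop
  | nil (x : A) : ChainSum ρ 0 x x 0
  | cons {n : ℕ} (x : A) {y z : A} {s : ℝ} (h : ChainSum ρ n y z s) :
    ChainSum ρ (n + 1) x z (ρ x y + s)

theorem ChainSum.append {m n : ℕ} {x y z : A} {s t : ℝ} (h : ChainSum ρ m x y s)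
    (h' : ChainSum ρ n y z t) : ∃ k, ChainSum ρ k x z (s + t) := by
  induction h with
  | nil x => exact ⟨n, by rwa [zero_add]⟩
  | cons x h ih =>
    obtain ⟨k, hk⟩ := ih h'
    exact ⟨k + 1, by rw [add_assoc]; exact hk.cons x⟩

theorem ChainSum.single (x y : A) : ChainSum ρ 1 x y (ρ x y) := by
  simpa using (ChainSum.nil (ρ := ρ) y).cons x

theorem ChainSum.symm (hs : ∀ x y, ρ x y = ρ y x) {n : ℕ} {x y : A} {s : ℝ}
    (h : ChainSum ρ n x y s) : ∃ k, ChainSum ρ k y x s := by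
  induction h with
  | nil x => exact ⟨0, ChainSum.nil x⟩
  | @cons n x y z s h ih =>
    obtain ⟨k, hk⟩ := ih
    rw [hs x y, add_comm]
    exact hk.append (ChainSum.single y x)

theorem ChainSum.nonneg (hn : ∀ x y, 0 ≤ ρ x y) {n : ℕ} {x y : A} {s : ℝ}
    (h : ChainSum ρ n x y s) : 0 ≤ s := by
  induction h with
  | nil x => exact le_rfl
  | cons x h ih => exact add_nonneg (hn _ _) ih

theorem ChainSum.eq_of_nonpos (hn : ∀ x y, 0 ≤ ρ x y) (he : ∀ x y, ρ x y = 0 → x = y) {n : ℕ}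
    {x y : A} {s : ℝ} (h : ChainSum ρ n x y s) (hs : s ≤ 0) : x = y := by
  induction h with
  | nil x => rfl
  | @cons n x y z s h ih =>
    have h1 := h.nonneg hn
    have h2 := hn x y
    exact (he x y (by linarith)).trans (ih (by linarith))

/-- A chain can be split at a link in the middle. -/
theorem ChainSum.split (hn : ∀ x y, 0 ≤ ρ x y) {n : ℕ} {x y : A} {s : ℝ}
    (h : ChainSum ρ n x y s) {a : ℝ} (ha : 0 ≤ a) (has : a < s) :
    ∃ z z' n₁ n₂ s₁ s₂, ChainSum ρ n₁ x z s₁ ∧ ChainSum ρ n₂ z' y s₂ ∧ n₁ < n ∧ n₂ < n ∧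
      s₁ ≤ a ∧ s₂ ≤ s - a ∧ ρ z z' ≤ s := by
  induction h generalizing a with
  | nil x => linarith
  | @cons n x y z s h ih =>
    have h0 := h.nonneg hn
    rcases lt_or_ge a (ρ x y) with hlt | hge
    · exact ⟨x, y, 0, n, 0, s, ChainSum.nil x, h, n.succ_pos, n.lt_succ_self, ha, by linarith,
        by linarith⟩
    · obtain ⟨w, w', n₁, n₂, s₁, s₂, h1, h2, h3, h4, h5, h6, h7⟩ :=
        ih (sub_nonneg.2 hge) (by linarith)
      exact ⟨w, w', n₁ + 1, n₂, _, s₂, h1.cons x, h2, by omega, by omega, by linarith,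
        by linarith, by linarith [hn x y]⟩

/-- Split the chain at a link such that the sums before and after it are at most `s / 2`, and induct
on both parts. The link costs `(1 - 2c)(1 + c)² ≤ 1` and the parts cost `(1 + c)² / 2 ≤ 1`. -/
theorem ChainSum.mul_le (hn : ∀ x y, 0 ≤ ρ x y) (h0 : ∀ x, ρ x x = 0)
    (he : ∀ x y, ρ x y = 0 → x = y) {c : ℝ} (hc : 0 ≤ c) (hc2 : (1 + c) ^ 2 ≤ 2)
    (hρ : ∀ x y z, ρ x z ≤ (1 + c) * max (ρ x y) (ρ y z)) (n : ℕ) :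
    ∀ {x y : A} {s : ℝ}, ChainSum ρ n x y s → (1 - 2 * c) * ρ x y ≤ s := by
  induction n using Nat.strong_induction_on with
  | h n ih =>
    intro x y s h
    rcases le_or_gt s 0 with hs | hs
    · rw [h.eq_of_nonpos hn he hs, h0, mul_zero]
      exact h.nonneg hn
    obtain ⟨z, z', n₁, n₂, s₁, s₂, h1, h2, h3, h4, h5, h6, h7⟩ :=
      h.split hn (half_pos hs).le (half_lt_self hs)
    have e1 := ih _ h3 h1
    have e2 := ih _ h4 h2
    have hk : 0 ≤ 1 - 2 * c := by nlinarith
    have hk1 : (1 - 2 * c) * (1 + c) ^ 2 ≤ 1 := by nlinarith [pow_nonneg hc 3]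
    have hk2 : 1 + c ≤ 2 := by nlinarith
    have f2 : (1 + c) * ((1 - 2 * c) * max (ρ z z') (ρ z' y)) * (1 + c) ≤ s := by
      rcases max_cases (ρ z z') (ρ z' y) with hm | hm <;> rw [hm.1]
      · have := mul_le_mul hk1 h7 (hn _ _) zero_le_one
        linarith
      · have := mul_le_mul_of_nonneg_left (e2.trans h6) (sq_nonneg (1 + c))
        nlinarith
    have f1 : (1 + c) * ((1 - 2 * c) * max (ρ x z) (ρ z y)) ≤ s := by
      rcases max_cases (ρ x z) (ρ z y) with hm | hm <;> rw [hm.1]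
      · have := mul_le_mul_of_nonneg_left (e1.trans h5) (by linarith : 0 ≤ 1 + c)
        nlinarith
      · refine le_trans ?_ f2
        have := mul_le_mul_of_nonneg_left (mul_le_mul_of_nonneg_left (hρ z z' y) hk)
          (by linarith : 0 ≤ 1 + c)
        linarith
    refine le_trans ?_ f1
    have := mul_le_mul_of_nonneg_left (hρ x z y) hk
    linarith

/-- The largest pseudometric below `ρ`. -/
def chainDist (ρ : A → A → ℝ) (x y : A) : ℝ := sInf {s | ∃ n, ChainSum ρ n x y s}

theorem chainDist_le (hn : ∀ x y, 0 ≤ ρ x y) {n : ℕ} {x y : A} {s : ℝ} (h : ChainSum ρ n x y s) :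
    chainDist ρ x y ≤ s :=
  csInf_le ⟨0, fun _ ⟨_, h⟩ => h.nonneg hn⟩ ⟨n, h⟩

theorem le_chainDist_iff (hn : ∀ x y, 0 ≤ ρ x y) {x y : A} {a : ℝ} :
    a ≤ chainDist ρ x y ↔ ∀ n s, ChainSum ρ n x y s → a ≤ s :=
  ⟨fun h _ _ hs => h.trans (chainDist_le hn hs), fun h =>
    le_csInf ⟨_, 1, ChainSum.single x y⟩ fun s ⟨n, hs⟩ => h n s hs⟩

/-- A pseudometric below `ρ` is below `chainDist ρ`. -/
theorem le_chainDist (hn : ∀ x y, 0 ≤ ρ x y) {m : A → A → ℝ} (h0 : ∀ x, m x x ≤ 0)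
    (ht : ∀ x y z, m x z ≤ m x y + m y z) (hm : ∀ x y, m x y ≤ ρ x y) (x y : A) :
    m x y ≤ chainDist ρ x y := by
  rw [le_chainDist_iff hn]
  intro n s h
  induction h with
  | nil x => exact h0 x
  | @cons n x y z s h ih => exact (ht x y z).trans (add_le_add (hm x y) ih)

theorem chainDist_nonneg (hn : ∀ x y, 0 ≤ ρ x y) (x y : A) : 0 ≤ chainDist ρ x y :=
  (le_chainDist_iff hn).2 fun _ _ h => h.nonneg hn

theorem chainDist_self (hn : ∀ x y, 0 ≤ ρ x y) (x : A) : chainDist ρ x x = 0 :=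
  le_antisymm (chainDist_le hn (ChainSum.nil x)) (chainDist_nonneg hn x x)

theorem chainDist_comm (hn : ∀ x y, 0 ≤ ρ x y) (hs : ∀ x y, ρ x y = ρ y x) (x y : A) :
    chainDist ρ x y = chainDist ρ y x := by
  have : ∀ x y, chainDist ρ x y ≤ chainDist ρ y x := fun x y =>
    (le_chainDist_iff hn).2 fun n s h => by
      obtain ⟨k, hk⟩ := h.symm hs
      exact chainDist_le hn hk
  exact le_antisymm (this x y) (this y x)

theorem chainDist_triangle (hn : ∀ x y, 0 ≤ ρ x y) (x y z : A) :
    chainDist ρ x z ≤ chainDist ρ x y + chainDist ρ y z := by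
  rw [← sub_le_iff_le_add, le_chainDist_iff hn]
  intro n s h
  rw [sub_le_comm, le_chainDist_iff hn]
  intro n' s' h'
  obtain ⟨k, hk⟩ := h.append h'
  rw [sub_le_iff_le_add']
  exact chainDist_le hn hk

/-- The pullback of `chainDist ρ'`, divided by `C`, is a pseudometric below `ρ`. Flip, isometries
and change of base point are all instances. -/
theorem chainDist_le_of_map {A' : Type*} {ρ' : A' → A' → ℝ} (hn : ∀ x y, 0 ≤ ρ x y)
    (hn' : ∀ x y, 0 ≤ ρ' x y) (f : A → A') {C : ℝ} (hC : 0 < C)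
    (h : ∀ x y, ρ' (f x) (f y) ≤ C * ρ x y) (x y : A) :
    chainDist ρ' (f x) (f y) ≤ C * chainDist ρ x y := by
  have := le_chainDist hn (m := fun x y => C⁻¹ * chainDist ρ' (f x) (f y))
    (fun x => by rw [chainDist_self hn', mul_zero])
    (fun x y z => by
      rw [← mul_add]
      exact mul_le_mul_of_nonneg_left (chainDist_triangle hn' _ _ _) (inv_nonneg.2 hC.le))
    (fun x y => by
      rw [inv_mul_le_iff₀ hC]
      exact (chainDist_le hn' (ChainSum.single _ _)).trans (h x y)) x y
  rwa [inv_mul_le_iff₀ hC] at this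

/-- The metric defined by a quasi-ultrametric. -/
@[reducible] def chainMetric (hn : ∀ x y, 0 ≤ ρ x y) (hs : ∀ x y, ρ x y = ρ y x)
    (he : ∀ x y, chainDist ρ x y = 0 → x = y) : MetricSpace A where
  dist := chainDist ρ
  dist_self := chainDist_self hn
  dist_comm := chainDist_comm hn hs
  dist_triangle := chainDist_triangle hn
  eq_of_dist_eq_zero := fun {x y} h => he x y h

end

section

variable {X : Type u} [MetricSpace X]

/-! ### The quasi-ultrametric `δ̃_x` -/

theorem deltaTilde_of_ne {B χ : ℝ} {x : X} {α β : ContractingPairs X B} (h : α ≠ β) :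
    deltaTilde B χ x α β = Real.exp (-χ * (tau B x α.1 β.1).toReal) :=
  if_neg h

theorem deltaTilde_self (B χ : ℝ) (x : X) (α : ContractingPairs X B) :
    deltaTilde B χ x α α = 0 :=
  if_pos rfl

theorem deltaTilde_nonneg (B χ : ℝ) (x : X) (α β : ContractingPairs X B) :
    0 ≤ deltaTilde B χ x α β := by
  rw [deltaTilde]
  split_ifs
  · exact le_rfl
  · exact (Real.exp_pos _).le

theorem eq_of_deltaTilde_eq_zero {B χ : ℝ} {x : X} {α β : ContractingPairs X B}
    (h : deltaTilde B χ x α β = 0) : α = β := by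
  by_contra hne
  rw [deltaTilde_of_ne hne] at h
  exact (Real.exp_pos _).ne' h

variable [IsCAT0 X]

theorem deltaTilde_comm (B χ : ℝ) (x : X) (α β : ContractingPairs X B) :
    deltaTilde B χ x α β = deltaTilde B χ x β α := by
  by_cases h : α = β
  · rw [h]
  · rw [deltaTilde_of_ne h, deltaTilde_of_ne (Ne.symm h), tau_comm]

theorem deltaTilde_flip (B χ : ℝ) (x : X) (α β : ContractingPairs X B) :
    deltaTilde B χ x (ContractingPairs.flip α) (ContractingPairs.flip β) =
      deltaTilde B χ x α β := by
  by_cases h : α = β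
  · rw [h, deltaTilde_self, deltaTilde_self]
  · have h' : ContractingPairs.flip α ≠ ContractingPairs.flip β := fun he => h <| by
      rw [← ContractingPairs.flip_flip α, he, ContractingPairs.flip_flip]
    rw [deltaTilde_of_ne h, deltaTilde_of_ne h']
    congr 3
    exact tau_swap B x _ _

theorem deltaTilde_map (B χ : ℝ) (g : X ≃ᵢ X) (x : X) (α β : ContractingPairs X B) :
    deltaTilde B χ (g x) (ContractingPairs.map g α) (ContractingPairs.map g β) =
      deltaTilde B χ x α β := by
  by_cases h : α = β
  · rw [h, deltaTilde_self, deltaTilde_self]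
  · have h' : ContractingPairs.map g α ≠ ContractingPairs.map g β := fun he => h <| by
      rw [← ContractingPairs.map_symm_map g α, he, ContractingPairs.map_symm_map]
    rw [deltaTilde_of_ne h, deltaTilde_of_ne h', tau_map]

theorem deltaTilde_le_exp_mul {B χ : ℝ} (hB : 0 < B) (hχ : 0 < χ) (x y : X)
    (α β : ContractingPairs X B) :
    deltaTilde B χ y α β ≤ Real.exp (χ * dist x y) * deltaTilde B χ x α β := by
  by_cases h : α = β
  · rw [h, deltaTilde_self, deltaTilde_self, mul_zero]
  rw [deltaTilde_of_ne h, deltaTilde_of_ne h, ← Real.exp_add, Real.exp_le_exp]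
  have h1 := ENNReal.toReal_mono (ENNReal.add_ne_top.2 ⟨tau_ne_top hB y h, ENNReal.ofReal_ne_top⟩)
    (tau_le_add_dist B x y α.1 β.1)
  rw [ENNReal.toReal_add (tau_ne_top hB y h) ENNReal.ofReal_ne_top,
    ENNReal.toReal_ofReal dist_nonneg] at h1
  nlinarith

/-- This is the exponential of `le_tau_of_le_tau`. Coinciding points are separate because
`deltaTilde` is then `0` by convention. -/
theorem deltaTilde_le_mul_max {B χ : ℝ} (hB : 0 < B) (hχ : 0 < χ) (x : X)
    (α β η : ContractingPairs X B) :
    deltaTilde B χ x α η ≤ Real.exp (χ * (612 * (B + 1))) *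
      max (deltaTilde B χ x α β) (deltaTilde B χ x β η) := by
  have hE : 1 ≤ Real.exp (χ * (612 * (B + 1))) := Real.one_le_exp (by positivity)
  by_cases h : α = η
  · rw [h, deltaTilde_self]
    exact mul_nonneg (by linarith) (le_max_of_le_left (deltaTilde_nonneg _ _ _ _ _))
  by_cases h1 : α = β
  · subst h1
    exact (le_max_right _ _).trans (le_mul_of_one_le_left
      (le_max_of_le_left (deltaTilde_nonneg _ _ _ _ _)) hE)
  by_cases h2 : β = η
  · subst h2
    exact (le_max_left _ _).trans (le_mul_of_one_le_left
      (le_max_of_le_left (deltaTilde_nonneg _ _ _ _ _)) hE)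
  have hT := le_tau_of_le_tau hB (x := x) (α := α) (β := β) (η := η)
    (T := min (tau B x α.1 β.1).toReal (tau B x β.1 η.1).toReal)
    (ENNReal.ofReal_le_of_le_toReal (min_le_left _ _))
    (ENNReal.ofReal_le_of_le_toReal (min_le_right _ _))
  rw [ENNReal.ofReal_le_iff_le_toReal (tau_ne_top hB x h)] at hT
  rw [deltaTilde_of_ne h, deltaTilde_of_ne h1, deltaTilde_of_ne h2,
    ← Real.exp_monotone.map_max, ← Real.exp_add, Real.exp_le_exp]
  rcases min_cases (tau B x α.1 β.1).toReal (tau B x β.1 η.1).toReal with hm | hm <;>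
    rw [hm.1] at hT
  · nlinarith [le_max_left (-χ * (tau B x α.1 β.1).toReal) (-χ * (tau B x β.1 η.1).toReal)]
  · nlinarith [le_max_right (-χ * (tau B x α.1 β.1).toReal) (-χ * (tau B x β.1 η.1).toReal)]

theorem ofReal_le_tau_self {B : ℝ} (hB : 0 < B) (x : X) (α : ContractingPairs X B) (T : ℝ) :
    ENNReal.ofReal T ≤ tau B x α.1 α.1 := by
  obtain ⟨ζ, h⟩ := α.2
  have hf : Fellow 0 (T + (4 * 0 + 316 * B + 111)) x ζ ζ := fun t _ => (dist_self _).le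
  have := hf.le_tau hB h h le_rfl
  rwa [add_sub_cancel_right] at this

/-! ### The topology of a metric comparable to `δ̃_x` -/

theorem induced_prod_coneTopology [ProperSpace X] {B : ℝ} (o : X) :
    TopologicalSpace.induced (Subtype.val : ContractingPairs X B → _)
        (@instTopologicalSpaceProd _ _ (coneTopology o) (coneTopology o)) =
      TopologicalSpace.induced (fun α : ContractingPairs X B => rayTo o α.1.1) inferInstance ⊓
        TopologicalSpace.induced (fun α : ContractingPairs X B => rayTo o α.1.2) inferInstance := by
  rw [coneTopology_eq_induced]
  unfold instTopologicalSpaceProd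
  rw [induced_inf]
  iterate 4 rw [induced_compose (tγ := _)]
  rfl

section Topology

variable {B χ k : ℝ} [MetricSpace (ContractingPairs X B)] {x : X}

/-- Balls and superlevel sets of `τ_B` correspond through the logarithm; the center belongs to the
latter since `τ_B(α, α) = ∞`. -/
theorem hasBasis_nhds_tau (hB : 0 < B) (hχ : 0 < χ) (hk : 0 < k)
    (h : ∀ α β : ContractingPairs X B, k * deltaTilde B χ x α β ≤ dist α β ∧
      dist α β ≤ deltaTilde B χ x α β) (α : ContractingPairs X B) :
    (𝓝 α).HasBasis (fun _ : ℝ => True) fun T => {β | ENNReal.ofReal T ≤ tau B x α.1 β.1} := by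
  refine Metric.nhds_basis_ball.to_hasBasis (fun ε hε => ?_) fun T _ => ?_
  · refine ⟨(1 - Real.log ε) / χ, trivial, fun β hβ => ?_⟩
    rw [Metric.mem_ball, dist_comm]
    refine (h α β).2.trans_lt ?_
    by_cases hne : α = β
    · rwa [hne, deltaTilde_self]
    rw [mem_ofPred_eq, ENNReal.ofReal_le_iff_le_toReal (tau_ne_top hB x hne), div_le_iff₀ hχ] at hβ
    rw [deltaTilde_of_ne hne, ← Real.lt_log_iff_exp_lt hε]
    linarith
  · refine ⟨k * Real.exp (-χ * T), by positivity, fun β hβ => ?_⟩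
    rw [Metric.mem_ball, dist_comm] at hβ
    by_cases hne : α = β
    · rw [← hne]
      exact ofReal_le_tau_self hB x α T
    have h1 := lt_of_mul_lt_mul_left ((h α β).1.trans_lt hβ) hk.le
    rw [deltaTilde_of_ne hne, Real.exp_lt_exp] at h1
    rw [mem_ofPred_eq, ENNReal.ofReal_le_iff_le_toReal (tau_ne_top hB x hne)]
    nlinarith

variable [ProperSpace X]

theorem toTopologicalSpace_eq_induced (hB : 0 < B) (hχ : 0 < χ) (hk : 0 < k)
    (h : ∀ α β : ContractingPairs X B, k * deltaTilde B χ x α β ≤ dist α β ∧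
      dist α β ≤ deltaTilde B χ x α β) (o : X) :
    (inferInstance : TopologicalSpace (ContractingPairs X B)) =
      TopologicalSpace.induced Subtype.val
        (@instTopologicalSpaceProd _ _ (coneTopology o) (coneTopology o)) := by
  rw [induced_prod_coneTopology]
  refine TopologicalSpace.ext_nhds fun α => ?_
  refine Eq.trans ?_ (nhds_inf.trans
    (congrArg₂ _ (nhds_induced _ _) (nhds_induced _ _))).symm
  have hbasis := hasBasis_nhds_tau hB hχ hk h α
  have h1 : Tendsto (fun β : ContractingPairs X B => rayTo o β.1.1) (𝓝 α) (𝓝 (rayTo o α.1.1)) :=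
    tendsto_rayTo fun R hR ε hε => by
      obtain ⟨T, hT⟩ := exists_dist_rayTo_lt_of_le_tau hB x o α hR hε
      exact hbasis.eventually_iff.2 ⟨T, trivial, fun β hβ => (hT β hβ).1⟩
  have h2 : Tendsto (fun β : ContractingPairs X B => rayTo o β.1.2) (𝓝 α) (𝓝 (rayTo o α.1.2)) :=
    tendsto_rayTo fun R hR ε hε => by
      obtain ⟨T, hT⟩ := exists_dist_rayTo_lt_of_le_tau hB x o α hR hε
      exact hbasis.eventually_iff.2 ⟨T, trivial, fun β hβ => (hT β hβ).2⟩
  refine le_antisymm (le_inf (tendsto_iff_comap.1 h1) (tendsto_iff_comap.1 h2)) ?_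
  refine hbasis.ge_iff.2 fun T _ => ?_
  obtain ⟨R, hR⟩ := exists_le_tau_of_dist_rayTo_lt hB x o α T
  refine mem_of_superset (inter_mem_inf
    (preimage_mem_comap (rayTo_dist_lt_mem_nhds o α.1.1 R zero_lt_one))
    (preimage_mem_comap (rayTo_dist_lt_mem_nhds o α.1.2 R zero_lt_one))) ?_
  exact fun β hβ => hR β hβ.1 hβ.2

theorem locallyCompactSpace_contractingPairs (hB : 0 < B) (hχ : 0 < χ) (hk : 0 < k)
    (h : ∀ α β : ContractingPairs X B, k * deltaTilde B χ x α β ≤ dist α β ∧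
      dist α β ≤ deltaTilde B χ x α β) : LocallyCompactSpace (ContractingPairs X B) := by
  have : WeaklyLocallyCompactSpace (ContractingPairs X B) := by
    refine ⟨fun α => ?_⟩
    obtain ⟨ε, hε, hsub⟩ := Metric.nhds_basis_closedBall.mem_iff.1
      -- Any threshold above `18B + 6` works: it is what makes the lines fellow travel and so gives
      -- compactness.
      ((hasBasis_nhds_tau hB hχ hk h α).mem_of_mem (i := 18 * B + 7) trivial)
    refine ⟨Metric.closedBall α ε, ?_, Metric.closedBall_mem_nhds α hε⟩
    rw [isCompact_iff_ultrafilter_le_nhds]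
    intro F hF
    rw [le_principal_iff] at hF
    obtain ⟨η, hη⟩ := exists_eventually_le_tau hB F (T := 18 * B + 7) (by linarith)
      (mem_of_superset hF hsub)
    have hle : (F : Filter (ContractingPairs X B)) ≤ 𝓝 η :=
      (hasBasis_nhds_tau hB hχ hk h η).ge_iff.2 fun T _ => hη T
    exact ⟨η, isClosed_iff_ultrafilter.1 Metric.isClosed_closedBall η F hle hF, hle⟩
  infer_instance

end Topology

end

end

/-! ### The chain metrics of `deltaTilde` and their properties -/

theorem mainTheorem8 :
    ∃ L : ℝ, 0 < L ∧ ∀ B : ℝ, 0 < B → ∀ χ : ℝ, 0 < χ → ∀ χ' : ℝ,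
      χ' = Real.exp (χ * (L * (B + 1))) - 1 → χ' < Real.sqrt 2 - 1 →
      ∀ (X : Type u) [MetricSpace X] [ProperSpace X] [IsCAT0 X],
      ∃ δ : X → MetricSpace (ContractingPairs X B),
        -- the topology of `δ_x` is the restriction of the product topology
        (∀ x o : X, (δ x).toUniformSpace.toTopologicalSpace =
          TopologicalSpace.induced Subtype.val
            (@instTopologicalSpaceProd _ _ (coneTopology o) (coneTopology o))) ∧
        (∀ x : X, @LocallyCompactSpace (ContractingPairs X B)
          (δ x).toUniformSpace.toTopologicalSpace) ∧
        -- invariance under the flip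
        (∀ (x : X) (α β : ContractingPairs X B),
          (δ x).dist (ContractingPairs.flip α) (ContractingPairs.flip β) = (δ x).dist α β) ∧
        -- comparison with `δ̃_x`
        (∀ (x : X) (α β : ContractingPairs X B),
          (1 - 2 * χ') * deltaTilde B χ x α β ≤ (δ x).dist α β ∧
            (δ x).dist α β ≤ deltaTilde B χ x α β) ∧
        -- dependence on the base point
        (∀ (x y : X) (α β : ContractingPairs X B),
          Real.exp (-χ * dist x y) * (δ x).dist α β ≤ (δ y).dist α β ∧
            (δ y).dist α β ≤ Real.exp (χ * dist x y) * (δ x).dist α β) ∧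
        -- invariance under the isometry group
        (∀ (g : X ≃ᵢ X) (x : X) (α β : ContractingPairs X B),
          (δ (g x)).dist (ContractingPairs.map g α) (ContractingPairs.map g β) =
            (δ x).dist α β) := by
  refine ⟨612, by norm_num, fun B hB χ hχ χ' hχ' hlt X _ _ _ => ?_⟩
  have hexp : Real.exp (χ * (612 * (B + 1))) = 1 + χ' := by rw [hχ']; ring
  have hχ0 : 0 ≤ χ' := by
    have := Real.one_le_exp (x := χ * (612 * (B + 1))) (by positivity)
    linarith
  -- This is the condition of the chain lemma; it also yields `1 - 2χ' > 0`, so that the chain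
  -- pseudometric separates points.
  have hsq : (1 + χ') ^ 2 ≤ 2 := by
    have h1 : 1 + χ' ≤ Real.sqrt 2 := by linarith
    exact (pow_le_pow_left₀ (by linarith) h1 2).trans_eq (Real.sq_sqrt zero_le_two)
  have hk : 0 < 1 - 2 * χ' := by nlinarith
  have hn := fun x : X => deltaTilde_nonneg (X := X) B χ x
  have hlow : ∀ (x : X) (α β : ContractingPairs X B),
      (1 - 2 * χ') * deltaTilde B χ x α β ≤ chainDist (deltaTilde B χ x) α β := fun x α β =>
    (le_chainDist_iff (hn x)).2 fun n s h =>
      h.mul_le (hn x) (deltaTilde_self B χ x) (fun _ _ => eq_of_deltaTilde_eq_zero) hχ0 hsq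
        (fun α β η => hexp ▸ deltaTilde_le_mul_max hB hχ x α β η) n
  have hup : ∀ (x : X) (α β : ContractingPairs X B),
      chainDist (deltaTilde B χ x) α β ≤ deltaTilde B χ x α β := fun x α β =>
    chainDist_le (hn x) (ChainSum.single α β)
  have hexpd : ∀ (x y : X) (α β : ContractingPairs X B), chainDist (deltaTilde B χ y) α β ≤
      Real.exp (χ * dist x y) * chainDist (deltaTilde B χ x) α β := fun x y =>
    chainDist_le_of_map (hn x) (hn y) id (Real.exp_pos _) fun α β =>
      deltaTilde_le_exp_mul hB hχ x y α β
  have hflip : ∀ (x : X) (α β : ContractingPairs X B), chainDist (deltaTilde B χ x)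
      (ContractingPairs.flip α) (ContractingPairs.flip β) ≤ chainDist (deltaTilde B χ x) α β :=
    fun x α β => by
      simpa using chainDist_le_of_map (hn x) (hn x) ContractingPairs.flip zero_lt_one
        (fun α β => by rw [one_mul, deltaTilde_flip]) α β
  have hmap : ∀ (g : X ≃ᵢ X) (x : X) (α β : ContractingPairs X B), chainDist (deltaTilde B χ (g x))
      (ContractingPairs.map g α) (ContractingPairs.map g β) ≤ chainDist (deltaTilde B χ x) α β :=
    fun g x α β => by
      simpa using chainDist_le_of_map (hn x) (hn (g x)) (ContractingPairs.map g) zero_lt_one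
        (fun α β => by rw [one_mul, deltaTilde_map]) α β
  let δ : X → MetricSpace (ContractingPairs X B) := fun x =>
    chainMetric (hn x) (deltaTilde_comm B χ x) fun α β h0 => by
      have h1 := hlow x α β
      rw [h0] at h1
      exact eq_of_deltaTilde_eq_zero (le_antisymm (by nlinarith) (hn x α β))
  refine ⟨δ, fun x o => ?_, fun x => ?_, fun x α β => ?_, fun x α β => ⟨hlow x α β, hup x α β⟩,
    fun x y α β => ⟨?_, hexpd x y α β⟩, fun g x α β => ?_⟩
  · let := δ x
    exact toTopologicalSpace_eq_induced hB hχ hk (fun α β => ⟨hlow x α β, hup x α β⟩) o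
  · let := δ x
    exact locallyCompactSpace_contractingPairs hB hχ hk fun α β => ⟨hlow x α β, hup x α β⟩
  · refine le_antisymm (hflip x α β) ?_
    have := hflip x (ContractingPairs.flip α) (ContractingPairs.flip β)
    rwa [ContractingPairs.flip_flip, ContractingPairs.flip_flip] at this
  · have h1 := hexpd y x α β
    rw [neg_mul, Real.exp_neg, inv_mul_le_iff₀ (Real.exp_pos _), dist_comm x y]
    exact h1
  · refine le_antisymm (hmap g x α β) ?_
    have := hmap g.symm (g x) (ContractingPairs.map g α) (ContractingPairs.map g β)
    rwa [g.symm_apply_apply, ContractingPairs.map_symm_map, ContractingPairs.map_symm_map] at this
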